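/- **Setting.** Let $(V,\eta)$ be a four-dimensional real vector space with an inner product of signature $(+,-,-,-)$, $C\ell(V)$ its Clifford algebra with $v^2=-\eta(v,v)$, $S$ an irreducible $C\ell(V)$-module and $\langle-,-\rangle$ a symplectic form on $S$ with $\langle v\cdot s,t\rangle=-\langle s,v\cdot t\rangle$. Let $\sigma$ be the spinor representation of $\mathfrak{so}(V)$ on $S$, i.e. $\sigma(v\wedge w)s=\tfrac14(v\cdot w-w\cdot v)\cdot s$ where $(v\wedge w)(u)=\eta(u,v)w-\eta(u,w)v$, and let $\kappa:S\times S\to V$ be the symmetric bilinear map with $\eta(\kappa(s,t),v)=\langle s,v\cdot t\rangle$. The Poincaré superalgebra is $\mathfrak p=V\oplus S\oplus\mathfrak{so}(V)$, with even part $V\oplus\mathfrak{so}(V)$, odd part $S$, summands of degree $-2,-1,0$, and nonzero brackets $[A,B]=AB-BA$, $[A,s]=\sigma(A)s$, $[A,v]=Av$, $[s,t]=\kappa(s,t)$. Let $\mathfrak a=V\oplus S\oplus\mathfrak h$ be a $\mathbb Z$-graded subalgebra of $\mathfrak p$ that differs from $\mathfrak p$ at most in degree $0$, and $\mathfrak a_-=V\oplus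 S$. Let $C^{d,1}(\mathfrak a_-,\mathfrak a)$ be the space of linear maps $\mathfrak a_-\to\mathfrak a$ of degree $d$ and $C^{d,2}(\mathfrak a_-,\mathfrak a)$ the space of bilinear maps $\zeta:\mathfrak a_-\times\mathfrak a_-\to\mathfrak a$ of degree $d$ with $\zeta(X,Y)=-(-1)^{xy}\zeta(Y,X)$ for $X,Y$ homogeneous of parities $x,y$. For even $d$ the Spencer differential $\partial$ (the Chevalley–Eilenberg differential of $\mathfrak a_-$ with values in $\mathfrak a$) is $$\partial\psi(X,Y)=[X,\psi(Y)]-(-1)^{xy}[Y,\psi(X)]-\psi([X,Y]),$$ $$\begin{aligned}\partial\zeta(X,Y,Z)={}&[X,\zeta(Y,Z)]+(-1)^{x(y+z)}[Y,\zeta(Z,X)]+(-1)^{z(x+y)}[Z,\zeta(X,Y)]\\&-\zeta([X,Y],Z)-(-1)^{x(y+z)}\zeta([Y,Z],X)-(-1)^{z(x+y)}\zeta([Z,X],Y),\end{aligned}$$ and $H^{2,2}(\mathfrak a_-,\mathfrak a)=\ker\partial|_{C^{2,2}}/\partial C^{2,1}$, an $\mathfrak h$-module under $(A\cdot\zeta)(X,Y)=[A,\zeta(X,Y)]-\zeta([A,X],Y)-\zeta(X,[A,Y])$.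 A filtered Lie superalgebra is a real Lie superalgebra $\mathfrak g$ with a decreasing filtration $(\mathfrak g^i)_{i\in\mathbb Z}$ by $\mathbb Z/2$-graded subspaces such that $\bigcup_i\mathfrak g^i=\mathfrak g$, $\bigcap_i\mathfrak g^i=0$ and $[\mathfrak g^i,\mathfrak g^j]\subset\mathfrak g^{i+j}$. A filtered deformation of $\mathfrak a$ is a filtered Lie superalgebra $\mathfrak g$ together with an isomorphism $\varphi$ of graded Lie superalgebras from its associated graded superalgebra $\bigoplus_i\mathfrak g^i/\mathfrak g^{i+1}$ to $\mathfrak a$. An adapted identification is an even linear isomorphism $\Theta:\mathfrak a\to\mathfrak g$ that maps $\mathfrak a_i$ into $\mathfrak g^i$ and induces $\varphi^{-1}$ on the associated graded spaces. Through $\Theta$ the bracket of $\mathfrak g$ becomes a bilinear map on $\mathfrak a$; let $\mu_\Theta$ be its component of degree $2$. **Proposition.** Let $\mathfrak g$ be a filtered deformation of $\mathfrak a$. Adapted identifications of $\mathfrak g$ exist, and: 1. for every adapted identification $\Theta$ the map $\mu_\Theta|_{\mathfrak a_-\otimes\mathfrak a_-}$ is a cocycle in $C^{2,2}(\mathfrak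 a_-,\mathfrak a)$, and its class $[\mu_\Theta|_{\mathfrak a_-\otimes\mathfrak a_-}]\in H^{2,2}(\mathfrak a_-,\mathfrak a)$ is $\mathfrak h$-invariant; 2. if $\mathfrak g'$ is another filtered deformation of $\mathfrak a$, and $[\mu'_{\Theta'}|_{\mathfrak a_-\otimes\mathfrak a_-}]=[\mu_\Theta|_{\mathfrak a_-\otimes\mathfrak a_-}]$ for some adapted identifications $\Theta$ of $\mathfrak g$ and $\Theta'$ of $\mathfrak g'$, then $\mathfrak g'$ and $\mathfrak g$ are isomorphic as filtered Lie superalgebras. -/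

import Mathlib

open DirectSum

set_option maxSynthPendingDepth 3
set_option linter.unusedSectionVars false

noncomputable section

/-! ### Lie superalgebras, gradings and filtrations -/

/-- The sign `(-1)^(i j)` attached to two parities. -/
def superSign (i j : ZMod 2) : ℝ := (-1) ^ (i.val * j.val)

/-- A real Lie superalgebra structure on the vector space `L`. -/
structure LieSuperalgebra (L : Type*) [AddCommGroup L] [Module ℝ L] where
  /-- the even part `part 0` and the odd part `part 1` -/
  part : ZMod 2 → Submodule ℝ L
  part_internal : DirectSum.IsInternal part
  bracket : L →ₗ[ℝ] L →ₗ[ℝ] L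
  bracket_mem : ∀ {i j : ZMod 2} {x y : L}, x ∈ part i → y ∈ part j →
    bracket x y ∈ part (i + j)
  skew : ∀ {i j : ZMod 2} {x y : L}, x ∈ part i → y ∈ part j →
    bracket x y = -(superSign i j • bracket y x)
  jacobi : ∀ {i j k : ZMod 2} {x y z : L}, x ∈ part i → y ∈ part j → z ∈ part k →
    bracket x (bracket y z) = bracket (bracket x y) z + superSign i j • bracket y (bracket x z)

/-- A `ℤ`-graded Lie superalgebra in which the parity is the degree modulo `2`. -/
structure GradedLieSuperalgebra (L : Type*) [AddCommGroup L] [Module ℝ L] extends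
    LieSuperalgebra L where
  deg : ℤ → Submodule ℝ L
  deg_internal : DirectSum.IsInternal deg
  deg_bracket_mem : ∀ {i j : ℤ} {x y : L}, x ∈ deg i → y ∈ deg j →
    bracket x y ∈ deg (i + j)
  deg_le_part : ∀ i : ℤ, deg i ≤ part (i : ZMod 2)

/-- A filtered Lie superalgebra: a decreasing, exhaustive and separated filtration by
`ℤ/2`-graded subspaces, compatible with the bracket. -/
structure FilteredLieSuperalgebra (L : Type*) [AddCommGroup L] [Module ℝ L] extends
    LieSuperalgebra L where
  filt : ℤ → Submodule ℝ L
  filt_antitone : Antitone filt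
  filt_exhaustive : ∀ x : L, ∃ i, x ∈ filt i
  filt_separated : ∀ x : L, (∀ i, x ∈ filt i) → x = 0
  filt_homogeneous : ∀ i, filt i = ⨆ e : ZMod 2, filt i ⊓ part e
  filt_bracket_mem : ∀ {i j : ℤ} {x y : L}, x ∈ filt i → y ∈ filt j →
    bracket x y ∈ filt (i + j)

/-- Isomorphisms of filtered Lie superalgebras. -/
structure FilteredIso {L M : Type*} [AddCommGroup L] [Module ℝ L] [AddCommGroup M] [Module ℝ M]
    (g : FilteredLieSuperalgebra L) (g' : FilteredLieSuperalgebra M) where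
  equiv : L ≃ₗ[ℝ] M
  map_bracket : ∀ x y, equiv (g.bracket x y) = g'.bracket (equiv x) (equiv y)
  map_part : ∀ (e : ZMod 2) (x : L), x ∈ g.part e ↔ equiv x ∈ g'.part e
  map_filt : ∀ (i : ℤ) (x : L), x ∈ g.filt i ↔ equiv x ∈ g'.filt i

/-! ### The associated graded superalgebra of a filtered Lie superalgebra -/

namespace FilteredLieSuperalgebra

variable {L : Type*} [AddCommGroup L] [Module ℝ L] (g : FilteredLieSuperalgebra L)

/-- The component of degree `i` of the associated graded superalgebra. -/
abbrev Gr (i : ℤ) : Type _ :=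
  ↥(g.filt i) ⧸ (g.filt (i + 1)).submoduleOf (g.filt i)

/-- The class in `Gr i` of an element of `filt i`. -/
def grMk (i : ℤ) : ↥(g.filt i) →ₗ[ℝ] g.Gr i :=
  ((g.filt (i + 1)).submoduleOf (g.filt i)).mkQ

/-- The part of parity `e` of the component of degree `i`. -/
def grPart (i : ℤ) (e : ZMod 2) : Submodule ℝ (g.Gr i) :=
  ((g.part e).submoduleOf (g.filt i)).map (g.grMk i)

/-- The bracket `filt i × filt j → filt (i + j)` followed by the passage to `Gr (i + j)`. -/
def preGrBracket (i j : ℤ) : ↥(g.filt i) →ₗ[ℝ] ↥(g.filt j) →ₗ[ℝ] g.Gr (i + j) :=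
  LinearMap.mk₂ ℝ
    (fun x y => g.grMk (i + j) ⟨g.bracket x y, g.filt_bracket_mem x.2 y.2⟩)
    (fun x x' y => by rw [← map_add]; congr 1; ext; simp)
    (fun c x y => by rw [← map_smul]; congr 1; ext; simp)
    (fun x y y' => by rw [← map_add]; congr 1; ext; simp)
    (fun c x y => by rw [← map_smul]; congr 1; ext; simp)

theorem preGrBracket_left (i j : ℤ) (x : ↥(g.filt i)) (hx : (x : L) ∈ g.filt (i + 1)) :
    g.preGrBracket i j x = 0 := by
  ext y
  refine (Submodule.Quotient.mk_eq_zero _).2 ?_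
  have := g.filt_bracket_mem hx y.2
  rw [show i + 1 + j = i + j + 1 by ring] at this
  exact this

theorem preGrBracket_right (i j : ℤ) (x : ↥(g.filt i)) (y : ↥(g.filt j))
    (hy : (y : L) ∈ g.filt (j + 1)) : g.preGrBracket i j x y = 0 := by
  refine (Submodule.Quotient.mk_eq_zero _).2 ?_
  have := g.filt_bracket_mem x.2 hy
  rw [← add_assoc] at this
  exact this

/-- The bracket of the associated graded superalgebra. -/
def grBracket (i j : ℤ) : g.Gr i →ₗ[ℝ] g.Gr j →ₗ[ℝ] g.Gr (i + j) :=
  LinearMap.flip (Submodule.liftQ _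
    (LinearMap.flip (Submodule.liftQ _ (g.preGrBracket i j)
      (fun x hx => g.preGrBracket_left i j x hx)))
    (fun y hy => by
      ext x
      exact g.preGrBracket_right i j x y hy))

theorem grBracket_mk (i j : ℤ) (x : ↥(g.filt i)) (y : ↥(g.filt j)) :
    g.grBracket i j (g.grMk i x) (g.grMk j y) =
      g.grMk (i + j) ⟨g.bracket x y, g.filt_bracket_mem x.2 y.2⟩ := rfl

end FilteredLieSuperalgebra

/-- An isomorphism of graded Lie superalgebras from the associated graded superalgebra of `g`
to `a`. A filtered deformation of `a` is a filtered Lie superalgebra `g` with such an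
isomorphism. -/
structure GrIso {L K : Type*} [AddCommGroup L] [Module ℝ L] [AddCommGroup K] [Module ℝ K]
    (g : FilteredLieSuperalgebra L) (a : GradedLieSuperalgebra K) where
  equiv : ∀ i : ℤ, g.Gr i ≃ₗ[ℝ] ↥(a.deg i)
  map_bracket : ∀ (i j : ℤ) (x : g.Gr i) (y : g.Gr j),
    (equiv (i + j) (g.grBracket i j x y) : K) = a.bracket (equiv i x) (equiv j y)
  map_part : ∀ (i : ℤ) (e : ZMod 2) (x : g.Gr i),
    x ∈ g.grPart i e ↔ (equiv i x : K) ∈ a.part e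

/-! ### Homogeneous components and the Spencer complex -/

namespace GradedLieSuperalgebra

variable {K : Type*} [AddCommGroup K] [Module ℝ K] (a : GradedLieSuperalgebra K)

/-- The decomposition of an element into its homogeneous components. -/
def decomp : K ≃ₗ[ℝ] ⨁ i, ↥(a.deg i) :=
  (LinearEquiv.ofBijective (DirectSum.coeLinearMap a.deg) a.deg_internal).symm

/-- The projection onto the component of degree `i`. -/
def proj (i : ℤ) : K →ₗ[ℝ] K :=
  (a.deg i).subtype ∘ₗ DirectSum.component ℝ ℤ (fun i => ↥(a.deg i)) i ∘ₗ a.decomp.toLinearMap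

theorem decomp_of_mem {i : ℤ} {x : K} (hx : x ∈ a.deg i) :
    a.decomp x = DirectSum.lof ℝ ℤ (fun i => ↥(a.deg i)) i ⟨x, hx⟩ := by
  refine (LinearEquiv.symm_apply_eq _).2 ?_
  exact (DirectSum.coeLinearMap_lof a.deg i ⟨x, hx⟩).symm

/-- The component of degree `d` of a bilinear map `B : K × K → K`. -/
def bilinComponent (d : ℤ) (B : K →ₗ[ℝ] K →ₗ[ℝ] K) : K →ₗ[ℝ] K →ₗ[ℝ] K :=
  (DirectSum.toModule ℝ ℤ (K →ₗ[ℝ] K) fun i =>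
    LinearMap.flip ((DirectSum.toModule ℝ ℤ (↥(a.deg i) →ₗ[ℝ] K) fun j =>
      LinearMap.flip ((B.compr₂ (a.proj (i + j + d))).domRestrict₁₂ (a.deg i) (a.deg j))) ∘ₗ
        a.decomp.toLinearMap)) ∘ₗ a.decomp.toLinearMap

theorem bilinComponent_apply (d : ℤ) (B : K →ₗ[ℝ] K →ₗ[ℝ] K) {i j : ℤ} {x y : K}
    (hx : x ∈ a.deg i) (hy : y ∈ a.deg j) :
    a.bilinComponent d B x y = a.proj (i + j + d) (B x y) := by
  simp [bilinComponent, a.decomp_of_mem hx, a.decomp_of_mem hy]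
  rfl

/-- The negatively graded part `a₋`. -/
def neg : Submodule ℝ K := ⨆ i : {i : ℤ // i < 0}, a.deg i

theorem deg_le_neg {i : ℤ} (hi : i < 0) : a.deg i ≤ a.neg :=
  le_iSup (fun i : {i : ℤ // i < 0} => a.deg i) ⟨i, hi⟩

theorem bracket_mem_neg {x y : K} (hx : x ∈ a.neg) (hy : y ∈ a.neg) :
    a.bracket x y ∈ a.neg := by
  refine Submodule.iSup_induction _ (motive := fun x => a.bracket x y ∈ a.neg) hx ?_ ?_ ?_
  · intro i x hx
    refine Submodule.iSup_induction _ (motive := fun y => a.bracket x y ∈ a.neg) hy ?_ ?_ ?_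
    · intro j y hy
      exact a.deg_le_neg (add_neg i.2 j.2) (a.deg_bracket_mem hx hy)
    · simp
    · intro y z hy hz
      rw [map_add]
      exact add_mem hy hz
  · simp
  · intro x z hx hz
    rw [map_add, LinearMap.add_apply]
    exact add_mem hx hz

theorem ad_mem_neg {A y : K} (hA : A ∈ a.deg 0) (hy : y ∈ a.neg) :
    a.bracket A y ∈ a.neg := by
  refine Submodule.iSup_induction _ (motive := fun y => a.bracket A y ∈ a.neg) hy ?_ ?_ ?_
  · intro j y hy
    refine a.deg_le_neg (i := 0 + j) ?_ (a.deg_bracket_mem hA hy)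
    rw [zero_add]
    exact j.2
  · simp
  · intro y z hy hz
    rw [map_add]
    exact add_mem hy hz

/-- The bracket of the subalgebra `a₋`. -/
def negBracket (x y : ↥a.neg) : ↥a.neg := ⟨a.bracket x y, a.bracket_mem_neg x.2 y.2⟩

/-- The adjoint action of the subalgebra of degree zero on `a₋`. -/
def adNeg (A : ↥(a.deg 0)) : ↥a.neg →ₗ[ℝ] ↥a.neg :=
  (a.bracket A).restrict fun _ hy => a.ad_mem_neg A.2 hy

/-- The space `C^{d,1}(a₋, a)` of Spencer `1`-cochains of degree `d`. -/
def cochains₁ (d : ℤ) : Submodule ℝ (↥a.neg →ₗ[ℝ] K) where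
  carrier := {ψ | ∀ (i : ℤ) (x : ↥a.neg), (x : K) ∈ a.deg i → ψ x ∈ a.deg (i + d)}
  add_mem' := fun hp hq i x hx => add_mem (hp i x hx) (hq i x hx)
  zero_mem' := fun _ _ _ => zero_mem _
  smul_mem' := fun c _ hp i x hx => Submodule.smul_mem _ c (hp i x hx)

/-- The space `C^{d,2}(a₋, a)` of Spencer `2`-cochains of degree `d`: linear maps of degree `d`
from the exterior square, in the super sense, of `a₋` to `a`. -/
def cochains₂ (d : ℤ) : Submodule ℝ (↥a.neg →ₗ[ℝ] ↥a.neg →ₗ[ℝ] K) where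
  carrier := {ζ |
    (∀ (i j : ℤ) (x y : ↥a.neg), (x : K) ∈ a.deg i → (y : K) ∈ a.deg j →
      ζ x y ∈ a.deg (i + j + d)) ∧
    (∀ (i j : ZMod 2) (x y : ↥a.neg), (x : K) ∈ a.part i → (y : K) ∈ a.part j →
      ζ x y = -(superSign i j • ζ y x))}
  add_mem' := fun hp hq =>
    ⟨fun i j x y hx hy => add_mem (hp.1 i j x y hx hy) (hq.1 i j x y hx hy),
      fun i j x y hx hy => by
        simp only [LinearMap.add_apply]
        rw [hp.2 i j x y hx hy, hq.2 i j x y hx hy, smul_add, neg_add]⟩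
  zero_mem' := ⟨fun _ _ _ _ _ _ => zero_mem _, fun _ _ _ _ _ _ => by simp⟩
  smul_mem' := fun c ζ hp =>
    ⟨fun i j x y hx hy => Submodule.smul_mem _ c (hp.1 i j x y hx hy),
      fun i j x y hx hy => by
        simp only [LinearMap.smul_apply]
        rw [hp.2 i j x y hx hy, smul_neg, smul_comm]⟩

/-- The Spencer differential `∂ψ(x, y)` of a `1`-cochain of even degree, for `x` of parity `i`
and `y` of parity `j`. -/
def spencer₁ (ψ : ↥a.neg →ₗ[ℝ] K) (i j : ZMod 2) (x y : ↥a.neg) : K :=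
  a.bracket x (ψ y) - superSign i j • a.bracket y (ψ x) - ψ (a.negBracket x y)

/-- The Spencer differential `∂ζ(x, y, z)` of a `2`-cochain of even degree, for `x`, `y`, `z` of
parities `i`, `j`, `k`. -/
def spencer₂ (ζ : ↥a.neg →ₗ[ℝ] ↥a.neg →ₗ[ℝ] K) (i j k : ZMod 2) (x y z : ↥a.neg) : K :=
  a.bracket x (ζ y z) + superSign i (j + k) • a.bracket y (ζ z x)
    + superSign k (i + j) • a.bracket z (ζ x y)
    - ζ (a.negBracket x y) z - superSign i (j + k) • ζ (a.negBracket y z) x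
    - superSign k (i + j) • ζ (a.negBracket z x) y

/-- The `2`-cocycles of (even) degree `d`. -/
def cocycles₂ (d : ℤ) : Submodule ℝ (↥a.neg →ₗ[ℝ] ↥a.neg →ₗ[ℝ] K) where
  carrier := {ζ | ζ ∈ a.cochains₂ d ∧ ∀ (i j k : ZMod 2) (x y z : ↥a.neg),
    (x : K) ∈ a.part i → (y : K) ∈ a.part j → (z : K) ∈ a.part k →
      a.spencer₂ ζ i j k x y z = 0}
  add_mem' := fun {p q} hp hq => ⟨add_mem hp.1 hq.1, fun i j k x y z hx hy hz => by
    have h := congrArg₂ (· + ·) (hp.2 i j k x y z hx hy hz) (hq.2 i j k x y z hx hy hz)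
    simp only [add_zero] at h
    rw [← h]
    simp only [spencer₂, LinearMap.add_apply, map_add, smul_add]
    abel⟩
  zero_mem' := ⟨zero_mem _, fun i j k x y z _ _ _ => by simp [spencer₂]⟩
  smul_mem' := fun c p hp => ⟨Submodule.smul_mem _ c hp.1, fun i j k x y z hx hy hz => by
    have h := congrArg (fun v => c • v) (hp.2 i j k x y z hx hy hz)
    simp only [smul_zero] at h
    rw [← h]
    simp only [spencer₂, LinearMap.smul_apply, map_smul]
    module⟩

/-- The `2`-coboundaries of (even) degree `d`. -/
def coboundaries₂ (d : ℤ) : Submodule ℝ (↥a.neg →ₗ[ℝ] ↥a.neg →ₗ[ℝ] K) where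
  carrier := {ζ | ∃ ψ ∈ a.cochains₁ d, ∀ (i j : ZMod 2) (x y : ↥a.neg),
    (x : K) ∈ a.part i → (y : K) ∈ a.part j → ζ x y = a.spencer₁ ψ i j x y}
  add_mem' := by
    rintro p q ⟨ψ, hψ, hp⟩ ⟨χ, hχ, hq⟩
    refine ⟨ψ + χ, add_mem hψ hχ, fun i j x y hx hy => ?_⟩
    rw [LinearMap.add_apply, LinearMap.add_apply, hp i j x y hx hy, hq i j x y hx hy]
    simp only [spencer₁, LinearMap.add_apply, map_add, smul_add]
    abel
  zero_mem' := ⟨0, zero_mem _, fun i j x y _ _ => by simp [spencer₁]⟩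
  smul_mem' := by
    rintro c p ⟨ψ, hψ, hp⟩
    refine ⟨c • ψ, Submodule.smul_mem _ c hψ, fun i j x y hx hy => ?_⟩
    rw [LinearMap.smul_apply, LinearMap.smul_apply, hp i j x y hx hy]
    simp only [spencer₁, LinearMap.smul_apply, map_smul]
    module

/-- The Spencer cohomology group `H^{d,2}(a₋, a)`, for even `d`. -/
abbrev H₂ (d : ℤ) : Type _ :=
  ↥(a.cocycles₂ d) ⧸ (a.coboundaries₂ d).submoduleOf (a.cocycles₂ d)

/-- The cohomology class of a `2`-cocycle. -/
def cohClass (d : ℤ) : ↥(a.cocycles₂ d) →ₗ[ℝ] a.H₂ d :=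
  ((a.coboundaries₂ d).submoduleOf (a.cocycles₂ d)).mkQ

/-- The action of the degree zero subalgebra on bilinear maps `a₋ × a₋ → a`:
`(A · ζ)(x, y) = [A, ζ(x, y)] - ζ([A, x], y) - ζ(x, [A, y])`. -/
def act₂ (A : ↥(a.deg 0)) :
    (↥a.neg →ₗ[ℝ] ↥a.neg →ₗ[ℝ] K) →ₗ[ℝ] (↥a.neg →ₗ[ℝ] ↥a.neg →ₗ[ℝ] K) where
  toFun ζ := ζ.compr₂ (a.bracket A) - ζ ∘ₗ a.adNeg A - ζ.compl₂ (a.adNeg A)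
  map_add' p q := by ext x y; simp; abel
  map_smul' c p := by ext x y; simp [smul_sub]

theorem act₂_apply (A : ↥(a.deg 0)) (ζ : ↥a.neg →ₗ[ℝ] ↥a.neg →ₗ[ℝ] K) (x y : ↥a.neg) :
    a.act₂ A ζ x y = a.bracket A (ζ x y) - ζ (a.adNeg A x) y - ζ x (a.adNeg A y) := rfl

theorem mem_part_zero {A : K} (hA : A ∈ a.deg 0) : A ∈ a.part 0 := by
  simpa using a.deg_le_part 0 hA

theorem ad_mem_part {A x : K} {i : ZMod 2} (hA : A ∈ a.deg 0) (hx : x ∈ a.part i) :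
    a.bracket A x ∈ a.part i := by
  simpa using a.bracket_mem (a.mem_part_zero hA) hx

theorem ad_mem_deg {A x : K} {i : ℤ} (hA : A ∈ a.deg 0) (hx : x ∈ a.deg i) :
    a.bracket A x ∈ a.deg i := by
  simpa using a.deg_bracket_mem hA hx

/-- The adjoint action of a degree zero element is a derivation. -/
theorem ad_bracket {A : K} (hA : A ∈ a.deg 0) (x y : K) :
    a.bracket A (a.bracket x y) =
      a.bracket (a.bracket A x) y + a.bracket x (a.bracket A y) := by
  have top := a.part_internal.submodule_iSup_eq_top
  have hx : x ∈ ⨆ e, a.part e := top ▸ Submodule.mem_top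
  have hy : y ∈ ⨆ e, a.part e := top ▸ Submodule.mem_top
  refine Submodule.iSup_induction _ (motive := fun x => a.bracket A (a.bracket x y) =
      a.bracket (a.bracket A x) y + a.bracket x (a.bracket A y)) hx ?_ (by simp) ?_
  · intro i x hx
    refine Submodule.iSup_induction _ (motive := fun y => a.bracket A (a.bracket x y) =
      a.bracket (a.bracket A x) y + a.bracket x (a.bracket A y)) hy ?_ (by simp) ?_
    · intro j y hy
      rw [a.jacobi (a.mem_part_zero hA) hx hy]
      simp [superSign]
    · intro y z h1 h2
      simp only [map_add, h1, h2]
      abel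
  · intro x z h1 h2
    simp only [map_add, LinearMap.add_apply, h1, h2]
    abel

theorem adNeg_negBracket (A : ↥(a.deg 0)) (x y : ↥a.neg) :
    a.adNeg A (a.negBracket x y) =
      a.negBracket (a.adNeg A x) y + a.negBracket x (a.adNeg A y) :=
  Subtype.ext (a.ad_bracket A.2 x y)

theorem act₂_mem_cochains {d : ℤ} (A : ↥(a.deg 0)) {ζ : ↥a.neg →ₗ[ℝ] ↥a.neg →ₗ[ℝ] K}
    (hζ : ζ ∈ a.cochains₂ d) : a.act₂ A ζ ∈ a.cochains₂ d := by
  refine ⟨fun i j x y hx hy => ?_, fun i j x y hx hy => ?_⟩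
  · rw [act₂_apply]
    exact sub_mem (sub_mem (a.ad_mem_deg A.2 (hζ.1 i j x y hx hy))
      (hζ.1 i j _ y (a.ad_mem_deg A.2 hx) hy)) (hζ.1 i j x _ hx (a.ad_mem_deg A.2 hy))
  · rw [act₂_apply, act₂_apply, hζ.2 i j x y hx hy,
      hζ.2 i j (a.adNeg A x) y (a.ad_mem_part A.2 hx) hy,
      hζ.2 i j x (a.adNeg A y) hx (a.ad_mem_part A.2 hy)]
    simp only [map_neg, map_smul]
    module

theorem act₂_mem_cocycles {d : ℤ} (A : ↥(a.deg 0)) {ζ : ↥a.neg →ₗ[ℝ] ↥a.neg →ₗ[ℝ] K}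
    (hζ : ζ ∈ a.cocycles₂ d) : a.act₂ A ζ ∈ a.cocycles₂ d := by
  refine ⟨a.act₂_mem_cochains A hζ.1, fun i j k x y z hx hy hz => ?_⟩
  have h0 := congrArg (a.bracket A) (hζ.2 i j k x y z hx hy hz)
  have h1 := hζ.2 i j k (a.adNeg A x) y z (a.ad_mem_part A.2 hx) hy hz
  have h2 := hζ.2 i j k x (a.adNeg A y) z hx (a.ad_mem_part A.2 hy) hz
  have h3 := hζ.2 i j k x y (a.adNeg A z) hx hy (a.ad_mem_part A.2 hz)
  have key : a.spencer₂ (a.act₂ A ζ) i j k x y z =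
      a.bracket A (a.spencer₂ ζ i j k x y z) - a.spencer₂ ζ i j k (a.adNeg A x) y z
        - a.spencer₂ ζ i j k x (a.adNeg A y) z - a.spencer₂ ζ i j k x y (a.adNeg A z) := by
    have c : ∀ x : ↥a.neg, ((a.adNeg A x : ↥a.neg) : K) = a.bracket A x := fun _ => rfl
    simp only [spencer₂, act₂_apply, adNeg_negBracket, map_add, map_sub, map_smul,
      a.ad_bracket A.2, LinearMap.add_apply, c]
    module
  rw [key, h0, h1, h2, h3]
  simp

theorem act₂_mem_coboundaries {d : ℤ} (A : ↥(a.deg 0)) {ζ : ↥a.neg →ₗ[ℝ] ↥a.neg →ₗ[ℝ] K}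
    (hζ : ζ ∈ a.coboundaries₂ d) : a.act₂ A ζ ∈ a.coboundaries₂ d := by
  obtain ⟨ψ, hψ, h⟩ := hζ
  refine ⟨a.bracket A ∘ₗ ψ - ψ ∘ₗ a.adNeg A, fun i x hx => ?_, fun i j x y hx hy => ?_⟩
  · exact sub_mem (a.ad_mem_deg A.2 (hψ i x hx)) (hψ i _ (a.ad_mem_deg A.2 hx))
  · have c : ∀ x : ↥a.neg, ((a.adNeg A x : ↥a.neg) : K) = a.bracket A x := fun _ => rfl
    rw [act₂_apply, h i j x y hx hy, h i j _ y (a.ad_mem_part A.2 hx) hy,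
      h i j x _ hx (a.ad_mem_part A.2 hy)]
    simp only [spencer₁, adNeg_negBracket, map_add, map_sub, map_smul, a.ad_bracket A.2,
      LinearMap.sub_apply, LinearMap.comp_apply, c]
    module

/-- The induced action of the degree zero subalgebra on `H^{d,2}(a₋, a)`. -/
def actH₂ (d : ℤ) (A : ↥(a.deg 0)) : a.H₂ d →ₗ[ℝ] a.H₂ d :=
  Submodule.mapQ _ _ ((a.act₂ A).restrict fun _ h => a.act₂_mem_cocycles A h)
    (fun _ h => a.act₂_mem_coboundaries A h)

/-- Invariance of a cohomology class under the degree zero subalgebra. -/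
def IsInvariantClass (d : ℤ) (c : a.H₂ d) : Prop := ∀ A : ↥(a.deg 0), a.actH₂ d A c = 0

end GradedLieSuperalgebra

/-! ### The degree `2` part of the bracket of a filtered deformation -/

/-- An identification of the super vector space `a` with the filtered super vector space `g`
that induces the given isomorphism of `a` with the associated graded superalgebra of `g`. -/
structure Splitting {L K : Type*} [AddCommGroup L] [Module ℝ L] [AddCommGroup K] [Module ℝ K]
    {g : FilteredLieSuperalgebra L} {a : GradedLieSuperalgebra K} (φ : GrIso g a) where
  equiv : K ≃ₗ[ℝ] L
  map_part : ∀ (e : ZMod 2) (x : K), x ∈ a.part e → equiv x ∈ g.part e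
  map_deg : ∀ (i : ℤ) (x : K), x ∈ a.deg i → equiv x ∈ g.filt i
  symbol : ∀ (i : ℤ) (x : K) (hx : x ∈ a.deg i),
    (φ.equiv i (g.grMk i ⟨equiv x, map_deg i x hx⟩) : K) = x

namespace Splitting

variable {L K : Type*} [AddCommGroup L] [Module ℝ L] [AddCommGroup K] [Module ℝ K]
  {g : FilteredLieSuperalgebra L} {a : GradedLieSuperalgebra K} {φ : GrIso g a}

/-- The bracket of `g` transported to the vector space `a`. -/
def bracket (Θ : Splitting φ) : K →ₗ[ℝ] K →ₗ[ℝ] K :=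
  (g.bracket.compl₁₂ Θ.equiv.toLinearMap Θ.equiv.toLinearMap).compr₂ Θ.equiv.symm.toLinearMap

/-- The restriction to `a₋ × a₋` of the component of degree `2` of the bracket of `g`. -/
def mu (Θ : Splitting φ) : ↥a.neg →ₗ[ℝ] ↥a.neg →ₗ[ℝ] K :=
  (a.bilinComponent 2 Θ.bracket).domRestrict₁₂ a.neg a.neg

end Splitting

/-! ### Graded subalgebras -/

/-- A `ℤ`-graded subalgebra of a graded Lie superalgebra. -/
structure GradedSubalgebra {L : Type*} [AddCommGroup L] [Module ℝ L]
    (p : GradedLieSuperalgebra L) where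
  carrier : Submodule ℝ L
  homogeneous : carrier = ⨆ i : ℤ, carrier ⊓ p.deg i
  bracket_mem : ∀ {x y : L}, x ∈ carrier → y ∈ carrier → p.bracket x y ∈ carrier

theorem isInternal_submoduleOf {ι L : Type*} [DecidableEq ι] [AddCommGroup L] [Module ℝ L]
    {P : ι → Submodule ℝ L} (hP : DirectSum.IsInternal P) (W : Submodule ℝ L)
    (hW : W ≤ ⨆ i, W ⊓ P i) : DirectSum.IsInternal fun i => (P i).submoduleOf W := by
  refine DirectSum.isInternal_submodule_of_iSupIndep_of_iSup_eq_top ?_ ?_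
  · have h := hP.submodule_iSupIndep
    intro i
    have hi := h i
    rw [Submodule.disjoint_def] at hi ⊢
    intro x hx hx'
    apply Subtype.ext
    refine hi x hx ?_
    have : (W.subtype x) ∈ (⨆ j, ⨆ (_ : j ≠ i), (P j).submoduleOf W).map W.subtype :=
      Submodule.mem_map_of_mem hx'
    rw [Submodule.map_iSup] at this
    have le : (⨆ j, (⨆ (_ : j ≠ i), (P j).submoduleOf W).map W.subtype) ≤
        ⨆ j, ⨆ (_ : j ≠ i), P j := by
      refine iSup_mono fun j => ?_
      rw [Submodule.map_iSup]
      exact iSup_mono fun _ => Submodule.map_comap_le _ _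
    exact le this
  · apply Submodule.map_injective_of_injective W.injective_subtype
    rw [Submodule.map_iSup, Submodule.map_top, Submodule.range_subtype]
    refine le_antisymm (iSup_le fun i => Submodule.map_subtype_le _ _) (hW.trans ?_)
    refine iSup_mono fun i => ?_
    rw [Submodule.submoduleOf, Submodule.map_comap_subtype]

/-- A graded subalgebra is a graded Lie superalgebra. -/
def GradedSubalgebra.toGraded {L : Type*} [AddCommGroup L] [Module ℝ L]
    {p : GradedLieSuperalgebra L} (a : GradedSubalgebra p) :
    GradedLieSuperalgebra ↥a.carrier where
  part e := (p.part e).submoduleOf a.carrier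
  part_internal := isInternal_submoduleOf p.part_internal _ (by
    conv_lhs => rw [a.homogeneous]
    exact iSup_le fun i => le_trans (inf_le_inf_left _ (p.deg_le_part i))
      (le_iSup (fun e => a.carrier ⊓ p.part e) (i : ZMod 2)))
  bracket := LinearMap.mk₂ ℝ (fun x y => ⟨p.bracket x y, a.bracket_mem x.2 y.2⟩)
    (fun x x' y => by ext; simp) (fun c x y => by ext; simp)
    (fun x y y' => by ext; simp) (fun c x y => by ext; simp)
  bracket_mem hx hy := p.bracket_mem hx hy
  skew hx hy := Subtype.ext (p.skew hx hy)
  jacobi hx hy hz := Subtype.ext (p.jacobi hx hy hz)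
  deg i := (p.deg i).submoduleOf a.carrier
  deg_internal := isInternal_submoduleOf p.deg_internal _ a.homogeneous.le
  deg_bracket_mem hx hy := p.deg_bracket_mem hx hy
  deg_le_part i := fun _ hx => p.deg_le_part i hx

/-! ### Lorentzian vector spaces and spinors -/

/-- The diagonal entries of the Lorentzian inner product in an orthonormal basis. -/
def lorentzSign : Fin 4 → ℝ := ![1, -1, -1, -1]

/-- A Lorentzian inner product of signature `(+,-,-,-)` on a four-dimensional vector space. -/
structure LorentzForm (V : Type*) [AddCommGroup V] [Module ℝ V] where
  form : LinearMap.BilinForm ℝ V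
  exists_basis : ∃ b : Module.Basis (Fin 4) ℝ V,
    ∀ i j, form (b i) (b j) = if i = j then lorentzSign i else 0

attribute [local instance] LieRing.ofAssociativeRing

namespace LorentzForm

variable {V : Type*} [AddCommGroup V] [Module ℝ V] (η : LorentzForm V)

/-- A chosen orthonormal basis. The notions defined through it below do not depend on it. -/
def basis : Module.Basis (Fin 4) ℝ V := η.exists_basis.choose

theorem form_basis (i j : Fin 4) :
    η.form (η.basis i) (η.basis j) = if i = j then lorentzSign i else 0 :=
  η.exists_basis.choose_spec i j

theorem lorentzSign_mul_self (i : Fin 4) : lorentzSign i * lorentzSign i = 1 := by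
  fin_cases i <;> simp [lorentzSign]

theorem form_basis_left (i : Fin 4) (v : V) :
    η.form (η.basis i) v = lorentzSign i * η.basis.repr v i := by
  have h : η.form (η.basis i) (∑ j, η.basis.repr v j • η.basis j) =
      lorentzSign i * η.basis.repr v i := by
    simp only [map_sum, map_smul, form_basis, smul_eq_mul]
    simp [mul_comm]
  rwa [η.basis.sum_repr v] at h

theorem symm (v w : V) : η.form v w = η.form w v := by
  have : η.form = η.form.flip := by
    refine η.basis.ext fun i => η.basis.ext fun j => ?_
    change η.form (η.basis i) (η.basis j) = η.form (η.basis j) (η.basis i)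
    rw [form_basis, form_basis]
    by_cases h : i = j
    · simp [h]
    · simp [h, Ne.symm h]
  exact congrArg (fun f => f v w) this

theorem sum_basis (v : V) :
    ∑ i, (lorentzSign i * η.form (η.basis i) v) • η.basis i = v := by
  conv_rhs => rw [← η.basis.sum_repr v]
  refine Finset.sum_congr rfl fun i _ => ?_
  rw [form_basis_left, ← mul_assoc, lorentzSign_mul_self, one_mul]

/-- The Lie algebra `so(V)` of skew-symmetric endomorphisms. -/
abbrev so : LieSubalgebra ℝ (Module.End ℝ V) := skewAdjointLieSubalgebra η.form

theorem so_skew (A : ↥η.so) (v w : V) : η.form (A.1 v) w = -η.form v (A.1 w) := by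
  have h := (LinearMap.mem_skewAdjointSubmodule (B := η.form) A.1).1 A.2
  simpa using h v w

/-- The quadratic form `v ↦ -η(v, v)`, so that `v² = -η(v, v)` in its Clifford algebra. -/
def quad : QuadraticForm ℝ V := -(LinearMap.BilinMap.toQuadraticMap η.form)

/-- The Clifford algebra `Cℓ(V)`, with `v² = -η(v, v)`. -/
abbrev Cl : Type _ := CliffordAlgebra η.quad

/-- The inclusion of `V` in the Clifford algebra. -/
abbrev ι : V →ₗ[ℝ] η.Cl := CliffordAlgebra.ι η.quad

theorem ι_sq (v : V) : η.ι v * η.ι v = algebraMap ℝ η.Cl (-η.form v v) := by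
  rw [CliffordAlgebra.ι_sq_scalar]
  rfl

theorem ι_mul_add_swap (v w : V) :
    η.ι v * η.ι w + η.ι w * η.ι v = (-2 * η.form v w) • (1 : η.Cl) := by
  have h1 := η.ι_sq (v + w)
  have h2 := η.ι_sq v
  have h3 := η.ι_sq w
  simp only [map_add, add_mul, mul_add, LinearMap.add_apply, h2, h3, η.symm w v] at h1
  simp only [Algebra.algebraMap_eq_smul_one] at h1
  have : η.ι v * η.ι w + η.ι w * η.ι v =
      ((-η.form v v) • (1 : η.Cl) + η.ι w * η.ι v + (η.ι v * η.ι w + (-η.form w w) • (1 : η.Cl)))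
        - (-η.form v v) • (1 : η.Cl) - (-η.form w w) • (1 : η.Cl) := by abel
  rw [this, h1]
  module

/-- The endomorphism `v ∧ w : u ↦ η(u, v) w - η(u, w) v`. -/
def wedge (v w : V) : Module.End ℝ V :=
  (η.form v).smulRight w - (η.form w).smulRight v

/-- The image in the Clifford algebra of an endomorphism of `V`, regarded as a bivector; the
embedding of `so(V)` in `Cℓ(V)` is its restriction, and it sends `v ∧ w` to `¼ [v, w]`
(see `spin_wedge`). -/
def spin : Module.End ℝ V →ₗ[ℝ] η.Cl where
  toFun A := (1 / 8 : ℝ) • ∑ i, lorentzSign i •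
    (η.ι (η.basis i) * η.ι (A (η.basis i)) - η.ι (A (η.basis i)) * η.ι (η.basis i))
  map_add' A B := by
    rw [← smul_add, ← Finset.sum_add_distrib]
    refine congrArg (fun z : η.Cl => (1 / 8 : ℝ) • z) (Finset.sum_congr rfl fun i _ => ?_)
    simp only [LinearMap.add_apply, map_add, mul_add, add_mul]
    module
  map_smul' c A := by
    rw [RingHom.id_apply, smul_comm c (1 / 8 : ℝ), Finset.smul_sum (r := c)]
    refine congrArg (fun z : η.Cl => (1 / 8 : ℝ) • z) (Finset.sum_congr rfl fun i _ => ?_)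
    simp only [LinearMap.smul_apply, map_smul, mul_smul_comm, smul_mul_assoc]
    module

theorem spin_wedge (v w : V) :
    η.spin (η.wedge v w) = (1 / 4 : ℝ) • (η.ι v * η.ι w - η.ι w * η.ι v) := by
  have h : ∀ u : V, ∑ i, (lorentzSign i * η.form (η.basis i) u) • η.ι (η.basis i) = η.ι u := by
    intro u
    conv_rhs => rw [← η.sum_basis u]
    simp
  have e : η.spin (η.wedge v w) = (1 / 8 : ℝ) •
      (((∑ i, (lorentzSign i * η.form (η.basis i) v) • η.ι (η.basis i)) * η.ι w
        - (∑ i, (lorentzSign i * η.form (η.basis i) w) • η.ι (η.basis i)) * η.ι v)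
      - (η.ι w * (∑ i, (lorentzSign i * η.form (η.basis i) v) • η.ι (η.basis i))
        - η.ι v * (∑ i, (lorentzSign i * η.form (η.basis i) w) • η.ι (η.basis i)))) := by
    simp only [spin, LinearMap.coe_mk, AddHom.coe_mk]
    congr 1
    simp only [Finset.sum_mul, Finset.mul_sum, ← Finset.sum_sub_distrib]
    refine Finset.sum_congr rfl fun i _ => ?_
    simp only [wedge, LinearMap.sub_apply, LinearMap.smulRight_apply, η.symm _ (η.basis i),
      map_sub, map_smul, mul_sub, sub_mul, mul_smul_comm, smul_mul_assoc]
    module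
  rw [e, h, h]
  module

theorem commutator_ι (x y u : V) :
    (η.ι x * η.ι y - η.ι y * η.ι x) * η.ι u - η.ι u * (η.ι x * η.ι y - η.ι y * η.ι x) =
      (4 * η.form x u) • η.ι y - (4 * η.form y u) • η.ι x := by
  have hx := η.ι_mul_add_swap x u
  have hy := η.ι_mul_add_swap y u
  have e : (η.ι x * η.ι y - η.ι y * η.ι x) * η.ι u - η.ι u * (η.ι x * η.ι y - η.ι y * η.ι x) =
      η.ι x * (η.ι y * η.ι u + η.ι u * η.ι y) - (η.ι x * η.ι u + η.ι u * η.ι x) * η.ι y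
      - η.ι y * (η.ι x * η.ι u + η.ι u * η.ι x)
      + (η.ι y * η.ι u + η.ι u * η.ι y) * η.ι x := by noncomm_ring
  rw [e, hx, hy]
  simp only [mul_smul_comm, smul_mul_assoc, mul_one, one_mul]
  module

theorem spin_commutator_ι (A : ↥η.so) (u : V) :
    η.spin A.1 * η.ι u - η.ι u * η.spin A.1 = η.ι (A.1 u) := by
  have e : η.spin A.1 * η.ι u - η.ι u * η.spin A.1 = (1 / 2 : ℝ) •
      (η.ι (A.1 (∑ i, (lorentzSign i * η.form (η.basis i) u) • η.basis i))
        + η.ι (∑ i, (lorentzSign i * η.form (η.basis i) (A.1 u)) • η.basis i)) := by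
    simp only [spin, LinearMap.coe_mk, AddHom.coe_mk, smul_mul_assoc, mul_smul_comm,
      ← smul_sub, Finset.sum_mul, Finset.mul_sum, ← Finset.sum_sub_distrib, map_sum, map_smul,
      ← Finset.sum_add_distrib, commutator_ι, so_skew]
    rw [Finset.smul_sum, Finset.smul_sum]
    refine Finset.sum_congr rfl fun i _ => ?_
    module
  rw [e, sum_basis, sum_basis]
  module

/-- Skew-symmetry of `A`, contracted with a bilinear map. -/
theorem sum_so_left {M : Type*} [AddCommGroup M] [Module ℝ M] (f : V →ₗ[ℝ] V →ₗ[ℝ] M)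
    (A : ↥η.so) :
    ∑ i, lorentzSign i • f (A.1 (η.basis i)) (η.basis i) =
      -∑ i, lorentzSign i • f (η.basis i) (A.1 (η.basis i)) := by
  have l : ∀ i, lorentzSign i • f (A.1 (η.basis i)) (η.basis i) =
      ∑ j, (lorentzSign i * lorentzSign j * η.form (η.basis j) (A.1 (η.basis i))) •
        f (η.basis j) (η.basis i) := by
    intro i
    conv_lhs => rw [← η.sum_basis (A.1 (η.basis i))]
    simp [Finset.smul_sum, smul_smul, mul_assoc]
  have r : ∀ j, lorentzSign j • f (η.basis j) (A.1 (η.basis j)) =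
      ∑ i, (lorentzSign i * lorentzSign j * η.form (η.basis i) (A.1 (η.basis j))) •
        f (η.basis j) (η.basis i) := by
    intro j
    conv_lhs => rw [← η.sum_basis (A.1 (η.basis j))]
    simp only [map_sum, map_smul, Finset.smul_sum, smul_smul]
    refine Finset.sum_congr rfl fun i _ => ?_
    congr 1
    ring
  rw [Finset.sum_congr rfl fun i _ => l i, Finset.sum_congr rfl fun i _ => r i,
    Finset.sum_comm, ← Finset.sum_neg_distrib]
  refine Finset.sum_congr rfl fun j _ => ?_
  rw [← Finset.sum_neg_distrib]
  refine Finset.sum_congr rfl fun i _ => ?_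
  rw [← neg_smul, η.symm (η.basis i), so_skew]
  congr 1
  ring

theorem spin_lie (A B : ↥η.so) :
    η.spin (⁅A, B⁆ : ↥η.so).1 = η.spin A.1 * η.spin B.1 - η.spin B.1 * η.spin A.1 := by
  have d : ∀ x y : V, η.spin A.1 * (η.ι x * η.ι y) - (η.ι x * η.ι y) * η.spin A.1 =
      η.ι (A.1 x) * η.ι y + η.ι x * η.ι (A.1 y) := by
    intro x y
    rw [← spin_commutator_ι, ← spin_commutator_ι]
    noncomm_ring
  have m1 := η.sum_so_left ((LinearMap.mul ℝ η.Cl).compl₁₂ η.ι (η.ι ∘ₗ B.1)) A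
  have m2 := η.sum_so_left ((LinearMap.mul ℝ η.Cl).flip.compl₁₂ η.ι (η.ι ∘ₗ B.1)) A
  simp only [LinearMap.compl₁₂_apply, LinearMap.mul_apply', LinearMap.comp_apply,
    LinearMap.flip_apply] at m1 m2
  have e : η.spin A.1 * η.spin B.1 - η.spin B.1 * η.spin A.1 = (1 / 8 : ℝ) •
      ((∑ i, lorentzSign i • (η.ι (A.1 (η.basis i)) * η.ι (B.1 (η.basis i))))
      - (∑ i, lorentzSign i • (η.ι (B.1 (η.basis i)) * η.ι (A.1 (η.basis i))))
      + ∑ i, lorentzSign i • (η.ι (η.basis i) * η.ι (A.1 (B.1 (η.basis i)))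
        - η.ι (A.1 (B.1 (η.basis i))) * η.ι (η.basis i))) := by
    conv_lhs =>
      rw [show η.spin B.1 = (1 / 8 : ℝ) • ∑ i, lorentzSign i •
        (η.ι (η.basis i) * η.ι (B.1 (η.basis i)) - η.ι (B.1 (η.basis i)) * η.ι (η.basis i))
        from rfl]
    simp only [smul_mul_assoc, mul_smul_comm, ← smul_sub, Finset.sum_mul, Finset.mul_sum,
      ← Finset.sum_sub_distrib, ← Finset.sum_add_distrib]
    congr 1
    refine Finset.sum_congr rfl fun i _ => ?_
    rw [← smul_add]
    congr 1
    have := congrArg₂ (· - ·) (d (η.basis i) (B.1 (η.basis i))) (d (B.1 (η.basis i)) (η.basis i))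
    rw [mul_sub, sub_mul, sub_sub_sub_comm, this]
    abel
  rw [e, m1, m2]
  simp only [spin, LinearMap.coe_mk, AddHom.coe_mk]
  congr 1
  rw [← Finset.sum_neg_distrib, ← Finset.sum_neg_distrib, ← Finset.sum_sub_distrib,
    ← Finset.sum_add_distrib]
  refine Finset.sum_congr rfl fun i _ => ?_
  have : (⁅A, B⁆ : ↥η.so).1 (η.basis i) =
      A.1 (B.1 (η.basis i)) - B.1 (A.1 (η.basis i)) := rfl
  rw [this]
  simp only [map_sub, mul_sub, sub_mul]
  module

end LorentzForm

/-- A symplectic form on the Clifford module `S` for which Clifford multiplication by vectors is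
skew-symmetric. -/
structure SpinorForm {V : Type*} [AddCommGroup V] [Module ℝ V] (η : LorentzForm V)
    (S : Type*) [AddCommGroup S] [Module ℝ S] [Module η.Cl S] where
  form : LinearMap.BilinForm ℝ S
  alternating : form.IsAlt
  nondegenerate : form.Nondegenerate
  clifford_skew : ∀ (v : V) (s t : S), form (η.ι v • s) t = -form s (η.ι v • t)

namespace SpinorForm

variable {V : Type*} [AddCommGroup V] [Module ℝ V] {η : LorentzForm V}
  {S : Type*} [AddCommGroup S] [Module ℝ S] [Module η.Cl S] [IsScalarTower ℝ η.Cl S]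

/-- The spinor representation of `so(V)` on `S`. -/
def sigma (η : LorentzForm V) (S : Type*) [AddCommGroup S] [Module ℝ S] [Module η.Cl S]
    [IsScalarTower ℝ η.Cl S] : ↥η.so →ₗ[ℝ] S →ₗ[ℝ] S :=
  LinearMap.mk₂ ℝ (fun A s => η.spin A.1 • s)
    (fun A B s => by simp [add_smul])
    (fun c A s => by simp)
    (fun A s t => by simp)
    (fun c A s => by rw [← algebraMap_smul η.Cl c s, ← algebraMap_smul η.Cl c (_ • s),
      ← mul_smul, ← mul_smul, Algebra.commutes])

theorem sigma_apply (A : ↥η.so) (s : S) : sigma η S A s = η.spin A.1 • s := rfl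

variable (ω : SpinorForm η S)

theorem form_symm (v : V) (s t : S) : ω.form s (η.ι v • t) = ω.form t (η.ι v • s) := by
  rw [← ω.alternating.neg_eq (η.ι v • s) t, ω.clifford_skew, neg_neg]

/-- Clifford multiplication as a bilinear map. -/
def cliffordMul (η : LorentzForm V) (S : Type*) [AddCommGroup S] [Module ℝ S] [Module η.Cl S]
    [IsScalarTower ℝ η.Cl S] : V →ₗ[ℝ] S →ₗ[ℝ] S :=
  LinearMap.mk₂ ℝ (fun v s => η.ι v • s)
    (fun v w s => by simp [add_smul])
    (fun c v s => by simp)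
    (fun v s t => by simp)
    (fun c v s => by rw [← algebraMap_smul η.Cl c s, ← algebraMap_smul η.Cl c (_ • s),
      ← mul_smul, ← mul_smul, Algebra.commutes])

/-- The symmetric bilinear map `κ : S × S → V` whose value `κ(s, s)` is the Dirac current of
`s`; it is determined by `η(κ(s, t), v) = ⟨s, v · t⟩` (see `form_kappa`). -/
def kappa : S →ₗ[ℝ] S →ₗ[ℝ] V :=
  ∑ i, lorentzSign i •
    ((ω.form.compl₂ (cliffordMul η S (η.basis i))).compr₂
      (LinearMap.toSpanSingleton ℝ V (η.basis i)))

theorem kappa_apply (s t : S) :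
    ω.kappa s t = ∑ i, (lorentzSign i * ω.form s (η.ι (η.basis i) • t)) • η.basis i := by
  simp [kappa, LinearMap.sum_apply, cliffordMul, smul_smul]

theorem form_kappa (s t : S) (v : V) :
    η.form (ω.kappa s t) v = ω.form s (η.ι v • t) := by
  have h : η.ι v • t = cliffordMul η S v t := rfl
  rw [h, kappa_apply]
  conv_rhs => rw [← η.sum_basis v]
  simp only [map_sum, map_smul, LinearMap.sum_apply, LinearMap.smul_apply, smul_eq_mul]
  refine Finset.sum_congr rfl fun i _ => ?_
  simp only [cliffordMul, LinearMap.mk₂_apply]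
  ring

theorem kappa_symm (s t : S) : ω.kappa s t = ω.kappa t s := by
  rw [kappa_apply, kappa_apply]
  exact Finset.sum_congr rfl fun i _ => by rw [ω.form_symm]

theorem form_sigma (A : ↥η.so) (s t : S) :
    ω.form (sigma η S A s) t = -ω.form s (sigma η S A t) := by
  have two : ∀ (x y : V) (s t : S),
      ω.form ((η.ι x * η.ι y) • s) t = ω.form s ((η.ι y * η.ι x) • t) := by
    intro x y s t
    rw [mul_smul, mul_smul, ω.clifford_skew, ω.clifford_skew, neg_neg]
  have r : ∀ u : S, sigma η S A u = (1 / 8 : ℝ) • ∑ i, lorentzSign i •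
      ((η.ι (η.basis i) * η.ι (A.1 (η.basis i))) • u -
        (η.ι (A.1 (η.basis i)) * η.ι (η.basis i)) • u) := by
    intro u
    rw [sigma_apply]
    simp only [LorentzForm.spin, LinearMap.coe_mk, AddHom.coe_mk, smul_assoc, Finset.sum_smul,
      sub_smul]
  rw [r, r]
  simp only [map_smul, map_sum, map_sub, LinearMap.smul_apply, LinearMap.sum_apply,
    LinearMap.sub_apply, two, smul_eq_mul]
  rw [← mul_neg, ← Finset.sum_neg_distrib]
  congr 1
  exact Finset.sum_congr rfl fun i _ => by ring

theorem sigma_ι (A : ↥η.so) (v : V) (s : S) :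
    sigma η S A (η.ι v • s) = η.ι v • sigma η S A s + η.ι (A.1 v) • s := by
  rw [sigma_apply, sigma_apply, ← η.spin_commutator_ι, sub_smul, mul_smul, mul_smul]
  abel

theorem sigma_lie (A B : ↥η.so) (s : S) :
    sigma η S ⁅A, B⁆ s = sigma η S A (sigma η S B s) - sigma η S B (sigma η S A s) := by
  simp only [sigma_apply]
  rw [η.spin_lie, sub_smul, mul_smul, mul_smul]

theorem kappa_equivariant (A : ↥η.so) (s t : S) :
    A.1 (ω.kappa s t) = ω.kappa (sigma η S A s) t + ω.kappa s (sigma η S A t) := by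
  have h : ∀ u : V, η.form (A.1 (ω.kappa s t)) u =
      η.form (ω.kappa (sigma η S A s) t + ω.kappa s (sigma η S A t)) u := by
    intro u
    rw [η.so_skew, map_add, LinearMap.add_apply, form_kappa, form_kappa, form_kappa,
      form_sigma, sigma_ι, map_add]
    ring
  rw [← η.sum_basis (A.1 (ω.kappa s t)), ← η.sum_basis (_ + _)]
  exact Finset.sum_congr rfl fun i _ => by rw [η.symm, h, η.symm]

end SpinorForm

/-! ### The Poincaré superalgebra -/

section Poincare

variable {V : Type*} [AddCommGroup V] [Module ℝ V] (η : LorentzForm V)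
  {S : Type*} [AddCommGroup S] [Module ℝ S] [Module η.Cl S] [IsScalarTower ℝ η.Cl S]

/-- The subspace of degree `i` of `V ⊕ S ⊕ so(V)`: it is `V`, `S`, `so(V)` for `i = -2, -1, 0`
and zero otherwise. -/
def poincareDeg (S : Type*) [AddCommGroup S] [Module ℝ S] (i : ℤ) :
    Submodule ℝ (V × S × ↥η.so) where
  carrier := {x | (i ≠ -2 → x.1 = 0) ∧ (i ≠ -1 → x.2.1 = 0) ∧ (i ≠ 0 → x.2.2 = 0)}
  add_mem' hx hy := ⟨fun h => by simp [hx.1 h, hy.1 h], fun h => by simp [hx.2.1 h, hy.2.1 h],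
    fun h => by simp [hx.2.2 h, hy.2.2 h]⟩
  zero_mem' := ⟨fun _ => rfl, fun _ => rfl, fun _ => rfl⟩
  smul_mem' c x hx := ⟨fun h => by simp [hx.1 h], fun h => by simp [hx.2.1 h],
    fun h => by simp [hx.2.2 h]⟩

/-- The even part `V ⊕ so(V)` and the odd part `S` of `V ⊕ S ⊕ so(V)`. -/
def poincarePart (S : Type*) [AddCommGroup S] [Module ℝ S] (e : ZMod 2) :
    Submodule ℝ (V × S × ↥η.so) where
  carrier := {x | (e ≠ 0 → x.1 = 0) ∧ (e ≠ 1 → x.2.1 = 0) ∧ (e ≠ 0 → x.2.2 = 0)}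
  add_mem' hx hy := ⟨fun h => by simp [hx.1 h, hy.1 h], fun h => by simp [hx.2.1 h, hy.2.1 h],
    fun h => by simp [hx.2.2 h, hy.2.2 h]⟩
  zero_mem' := ⟨fun _ => rfl, fun _ => rfl, fun _ => rfl⟩
  smul_mem' c x hx := ⟨fun h => by simp [hx.1 h], fun h => by simp [hx.2.1 h],
    fun h => by simp [hx.2.2 h]⟩

/-- The bracket of the Poincaré superalgebra: `[A, B] = AB - BA`, `[A, s] = σ(A)s`, `[A, v] = Av`
and `[s, t] = κ(s, t)`, the other brackets being zero. -/
def poincareBracket (ω : SpinorForm η S) :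
    (V × S × ↥η.so) →ₗ[ℝ] (V × S × ↥η.so) →ₗ[ℝ] (V × S × ↥η.so) :=
  LinearMap.mk₂ ℝ
    (fun x y => (x.2.2.1 y.1 - y.2.2.1 x.1 + ω.kappa x.2.1 y.2.1,
      SpinorForm.sigma η S x.2.2 y.2.1 - SpinorForm.sigma η S y.2.2 x.2.1, ⁅x.2.2, y.2.2⁆))
    (fun x x' y => by
      refine Prod.ext ?_ (Prod.ext ?_ ?_)
      · simp; abel
      · simp; abel
      · simp)
    (fun c x y => by
      refine Prod.ext ?_ (Prod.ext ?_ ?_) <;> simp [smul_sub])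
    (fun x y y' => by
      refine Prod.ext ?_ (Prod.ext ?_ ?_)
      · simp; abel
      · simp; abel
      · simp)
    (fun c x y => by
      refine Prod.ext ?_ (Prod.ext ?_ ?_) <;> simp [smul_sub])

theorem poincareBracket_apply (ω : SpinorForm η S) (x y : V × S × ↥η.so) :
    poincareBracket η ω x y =
      (x.2.2.1 y.1 - y.2.2.1 x.1 + ω.kappa x.2.1 y.2.1,
      SpinorForm.sigma η S x.2.2 y.2.1 - SpinorForm.sigma η S y.2.2 x.2.1, ⁅x.2.2, y.2.2⁆) := rfl

theorem poincareDeg_internal (S : Type*) [AddCommGroup S] [Module ℝ S] :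
    DirectSum.IsInternal (poincareDeg η S) := by
  refine DirectSum.isInternal_submodule_of_iSupIndep_of_iSup_eq_top ?_ ?_
  · intro i
    let N : Submodule ℝ (V × S × ↥η.so) :=
      { carrier := {x | (i = -2 → x.1 = 0) ∧ (i = -1 → x.2.1 = 0) ∧ (i = 0 → x.2.2 = 0)}
        add_mem' := fun hx hy => ⟨fun h => by simp [hx.1 h, hy.1 h],
          fun h => by simp [hx.2.1 h, hy.2.1 h], fun h => by simp [hx.2.2 h, hy.2.2 h]⟩
        zero_mem' := ⟨fun _ => rfl, fun _ => rfl, fun _ => rfl⟩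
        smul_mem' := fun c x hx => ⟨fun h => by simp [hx.1 h], fun h => by simp [hx.2.1 h],
          fun h => by simp [hx.2.2 h]⟩ }
    have hN : (⨆ j, ⨆ (_ : j ≠ i), poincareDeg η S j) ≤ N := by
      refine iSup_le fun j => iSup_le fun hj x hx => ?_
      exact ⟨fun h => hx.1 (h ▸ hj), fun h => hx.2.1 (h ▸ hj), fun h => hx.2.2 (h ▸ hj)⟩
    refine Disjoint.mono_right hN ?_
    rw [Submodule.disjoint_def]
    intro x hx hx'
    refine Prod.ext ?_ (Prod.ext ?_ ?_)
    · by_cases h : i = -2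
      · exact hx'.1 h
      · exact hx.1 h
    · by_cases h : i = -1
      · exact hx'.2.1 h
      · exact hx.2.1 h
    · by_cases h : i = 0
      · exact hx'.2.2 h
      · exact hx.2.2 h
  · refine eq_top_iff.2 fun x _ => ?_
    have e : x = (x.1, 0, 0) + (0, x.2.1, 0) + (0, 0, x.2.2) := by simp
    rw [e]
    refine add_mem (add_mem ?_ ?_) ?_
    · exact Submodule.mem_iSup_of_mem (-2) ⟨by simp, by simp, by simp⟩
    · exact Submodule.mem_iSup_of_mem (-1) ⟨by simp, by simp, by simp⟩
    · exact Submodule.mem_iSup_of_mem 0 ⟨by simp, by simp, by simp⟩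

theorem poincarePart_internal (S : Type*) [AddCommGroup S] [Module ℝ S] :
    DirectSum.IsInternal (poincarePart η S) := by
  refine DirectSum.isInternal_submodule_of_iSupIndep_of_iSup_eq_top ?_ ?_
  · intro i
    let N : Submodule ℝ (V × S × ↥η.so) :=
      { carrier := {x | (i = 0 → x.1 = 0) ∧ (i = 1 → x.2.1 = 0) ∧ (i = 0 → x.2.2 = 0)}
        add_mem' := fun hx hy => ⟨fun h => by simp [hx.1 h, hy.1 h],
          fun h => by simp [hx.2.1 h, hy.2.1 h], fun h => by simp [hx.2.2 h, hy.2.2 h]⟩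
        zero_mem' := ⟨fun _ => rfl, fun _ => rfl, fun _ => rfl⟩
        smul_mem' := fun c x hx => ⟨fun h => by simp [hx.1 h], fun h => by simp [hx.2.1 h],
          fun h => by simp [hx.2.2 h]⟩ }
    have hN : (⨆ j, ⨆ (_ : j ≠ i), poincarePart η S j) ≤ N := by
      refine iSup_le fun j => iSup_le fun hj x hx => ?_
      exact ⟨fun h => hx.1 (h ▸ hj), fun h => hx.2.1 (h ▸ hj), fun h => hx.2.2 (h ▸ hj)⟩
    refine Disjoint.mono_right hN ?_
    rw [Submodule.disjoint_def]
    intro x hx hx'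
    refine Prod.ext ?_ (Prod.ext ?_ ?_)
    · by_cases h : i = 0
      · exact hx'.1 h
      · exact hx.1 h
    · by_cases h : i = 1
      · exact hx'.2.1 h
      · exact hx.2.1 h
    · by_cases h : i = 0
      · exact hx'.2.2 h
      · exact hx.2.2 h
  · refine eq_top_iff.2 fun x _ => ?_
    have e : x = (x.1, 0, x.2.2) + (0, x.2.1, 0) := by simp
    rw [e]
    refine add_mem ?_ ?_
    · exact Submodule.mem_iSup_of_mem 0 ⟨by simp, by simp, by simp⟩
    · exact Submodule.mem_iSup_of_mem 1 ⟨by simp, by simp, by simp⟩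

theorem poincarePart_cases {e : ZMod 2} {x : V × S × ↥η.so} (hx : x ∈ poincarePart η S e) :
    (e = 0 ∧ ∃ v A, x = (v, 0, A)) ∨ (e = 1 ∧ ∃ s, x = (0, s, 0)) := by
  have he : e = 0 ∨ e = 1 := (by decide : ∀ e : ZMod 2, e = 0 ∨ e = 1) e
  obtain ⟨v, s, A⟩ := x
  obtain ⟨h1, h2, h3⟩ := hx
  rcases he with rfl | rfl
  · have hs : s = 0 := h2 (by decide)
    exact Or.inl ⟨rfl, v, A, by rw [hs]⟩
  · have hv : v = 0 := h1 (by decide)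
    have hA : A = 0 := h3 (by decide)
    exact Or.inr ⟨rfl, s, by rw [hv, hA]⟩

theorem mem_poincarePart_even (v : V) (A : ↥η.so) :
    ((v, 0, A) : V × S × ↥η.so) ∈ poincarePart η S 0 :=
  ⟨fun h => absurd rfl h, fun _ => rfl, fun h => absurd rfl h⟩

theorem mem_poincarePart_odd (s : S) :
    ((0, s, 0) : V × S × ↥η.so) ∈ poincarePart η S 1 :=
  ⟨fun _ => rfl, fun h => absurd rfl h, fun _ => rfl⟩

theorem superSign_zero_left (e : ZMod 2) : superSign 0 e = 1 := by simp [superSign]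

theorem superSign_zero_right (e : ZMod 2) : superSign e 0 = 1 := by simp [superSign]

theorem superSign_one_one : superSign 1 1 = -1 := by
  simp [superSign, ZMod.val_one]

section brackets

variable (ω : SpinorForm η S)

theorem bracket_even_even (v w : V) (A B : ↥η.so) :
    poincareBracket η ω (v, 0, A) (w, 0, B) = (A.1 w - B.1 v, 0, ⁅A, B⁆) := by
  simp [poincareBracket_apply]

theorem bracket_even_odd (v : V) (A : ↥η.so) (s : S) :
    poincareBracket η ω (v, 0, A) (0, s, 0) = (0, SpinorForm.sigma η S A s, 0) := by
  simp [poincareBracket_apply]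

theorem bracket_odd_even (v : V) (A : ↥η.so) (s : S) :
    poincareBracket η ω (0, s, 0) (v, 0, A) = (0, -SpinorForm.sigma η S A s, 0) := by
  simp [poincareBracket_apply]

theorem bracket_odd_odd (s t : S) :
    poincareBracket η ω (0, s, 0) (0, t, 0) = (ω.kappa s t, 0, 0) := by
  simp [poincareBracket_apply]

end brackets

theorem poincareBracket_mem (ω : SpinorForm η S) {i j : ZMod 2} {x y : V × S × ↥η.so}
    (hx : x ∈ poincarePart η S i) (hy : y ∈ poincarePart η S j) :
    poincareBracket η ω x y ∈ poincarePart η S (i + j) := by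
  rcases poincarePart_cases η hx with ⟨rfl, v, A, rfl⟩ | ⟨rfl, s, rfl⟩ <;>
    rcases poincarePart_cases η hy with ⟨rfl, w, B, rfl⟩ | ⟨rfl, t, rfl⟩
  · rw [bracket_even_even]
    exact mem_poincarePart_even η _ _
  · rw [bracket_even_odd, zero_add]
    exact mem_poincarePart_odd η _
  · rw [bracket_odd_even, add_zero]
    exact mem_poincarePart_odd η _
  · rw [bracket_odd_odd, show (1 + 1 : ZMod 2) = 0 by decide]
    exact mem_poincarePart_even η _ _

theorem poincareBracket_skew (ω : SpinorForm η S) {i j : ZMod 2} {x y : V × S × ↥η.so}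
    (hx : x ∈ poincarePart η S i) (hy : y ∈ poincarePart η S j) :
    poincareBracket η ω x y = -(superSign i j • poincareBracket η ω y x) := by
  rcases poincarePart_cases η hx with ⟨rfl, v, A, rfl⟩ | ⟨rfl, s, rfl⟩ <;>
    rcases poincarePart_cases η hy with ⟨rfl, w, B, rfl⟩ | ⟨rfl, t, rfl⟩
  · simp [bracket_even_even, superSign_zero_left]
  · simp [bracket_even_odd, bracket_odd_even, superSign_zero_left]
  · simp [bracket_even_odd, bracket_odd_even, superSign_zero_right]
  · simp [bracket_odd_odd, superSign_one_one, ω.kappa_symm s t]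

theorem poincareBracket_jacobi (ω : SpinorForm η S) {i j k : ZMod 2} {x y z : V × S × ↥η.so}
    (hx : x ∈ poincarePart η S i) (hy : y ∈ poincarePart η S j) (hz : z ∈ poincarePart η S k) :
    poincareBracket η ω x (poincareBracket η ω y z) =
      poincareBracket η ω (poincareBracket η ω x y) z +
        superSign i j • poincareBracket η ω y (poincareBracket η ω x z) := by
  have br : ∀ (A B : ↥η.so) (v : V), (⁅A, B⁆ : ↥η.so).1 v = A.1 (B.1 v) - B.1 (A.1 v) :=
    fun _ _ _ => rfl
  rcases poincarePart_cases η hx with ⟨rfl, v, A, rfl⟩ | ⟨rfl, s, rfl⟩ <;>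
    rcases poincarePart_cases η hy with ⟨rfl, w, B, rfl⟩ | ⟨rfl, t, rfl⟩ <;>
    rcases poincarePart_cases η hz with ⟨rfl, u, C, rfl⟩ | ⟨rfl, r, rfl⟩
  · simp only [bracket_even_even, superSign_zero_left, one_smul]
    refine Prod.ext ?_ (Prod.ext ?_ ?_)
    · simp only [Prod.fst_add, br, map_sub]
      abel
    · simp
    · exact leibniz_lie A B C
  · simp only [bracket_even_even, bracket_even_odd, superSign_zero_left, one_smul,
      SpinorForm.sigma_lie]
    simp
  · simp only [bracket_even_even, bracket_even_odd, bracket_odd_even, superSign_zero_left,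
      one_smul, SpinorForm.sigma_lie]
    simp
    abel
  · simp only [bracket_even_even, bracket_even_odd, bracket_odd_odd, superSign_zero_left,
      one_smul]
    simp [ω.kappa_equivariant]
  · simp only [bracket_even_even, bracket_even_odd, bracket_odd_even, superSign_zero_right,
      one_smul, SpinorForm.sigma_lie]
    simp
    abel
  · simp only [bracket_even_even, bracket_even_odd, bracket_odd_even, bracket_odd_odd,
      superSign_zero_right, one_smul]
    simp [ω.kappa_equivariant]
  · simp only [bracket_odd_even, bracket_odd_odd, bracket_even_even, superSign_one_one]
    simp [ω.kappa_equivariant, ω.kappa_symm t]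
  · simp only [bracket_even_odd, bracket_odd_even, bracket_odd_odd, superSign_one_one]
    simp

/-- The `N = 1` Poincaré superalgebra `V ⊕ S ⊕ so(V)`. -/
def poincare (ω : SpinorForm η S) : GradedLieSuperalgebra (V × S × ↥η.so) where
  part := poincarePart η S
  part_internal := poincarePart_internal η S
  bracket := poincareBracket η ω
  bracket_mem := poincareBracket_mem η ω
  skew := poincareBracket_skew η ω
  jacobi := poincareBracket_jacobi η ω
  deg := poincareDeg η S
  deg_internal := poincareDeg_internal η S
  deg_bracket_mem := by
    rintro i j ⟨v, s, A⟩ ⟨w, t, B⟩ ⟨h1, h2, h3⟩ ⟨k1, k2, k3⟩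
    dsimp only at h1 h2 h3 k1 k2 k3
    rw [poincareBracket_apply]
    refine ⟨fun h => ?_, fun h => ?_, fun h => ?_⟩ <;> dsimp only at h ⊢
    · have e1 : A.1 w = 0 := by
        by_cases hi : i = 0
        · rw [k1 (by omega), map_zero]
        · simp [h3 hi]
      have e2 : B.1 v = 0 := by
        by_cases hi : j = 0
        · rw [h1 (by omega), map_zero]
        · simp [k3 hi]
      have e3 : ω.kappa s t = 0 := by
        by_cases hi : i = -1
        · rw [k2 (by omega), map_zero]
        · simp [h2 hi]
      simp [e1, e2, e3]
    · have e1 : SpinorForm.sigma η S A t = 0 := by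
        by_cases hi : i = 0
        · rw [k2 (by omega), map_zero]
        · simp [h3 hi]
      have e2 : SpinorForm.sigma η S B s = 0 := by
        by_cases hi : j = 0
        · rw [h2 (by omega), map_zero]
        · simp [k3 hi]
      simp [e1, e2]
    · by_cases hi : i = 0
      · rw [k3 (by omega), lie_zero]
      · rw [h3 hi, zero_lie]
  deg_le_part := by
    rintro i ⟨v, s, A⟩ ⟨h1, h2, h3⟩
    refine ⟨fun h => h1 ?_, fun h => h2 ?_, fun h => h3 ?_⟩
    · rintro rfl
      exact h (by decide)
    · rintro rfl
      exact h (by decide)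
    · rintro rfl
      exact h (by decide)

end Poincare

end

/-! Lift `a` to `g` degree by degree and transport the bracket back. The filtration excludes
components of negative degree, and compatibility with symbols makes the degree-zero component the
bracket of `a`. Parity excludes odd degrees, and since `a` lives in degrees -2, -1, 0 nothing of
degree above 4 survives. So the transported bracket is `[-,-] + μ + ρ`, with `μ` of degree 2 and `ρ`
of degree 4 (`bracket_eq`), and the Jacobi identity splits by degree (`jac_bracket_deg`).

Its degree-2 part on three elements of `a₋` says that `μ` is a Spencer cocycle (`mu_mem_cocycles`).
The same identity with one argument `A` of degree 0 says that `A · μ` is the differential of the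
contraction `μ(A, -)` (`act_quad`), which is invariance of the class.

For uniqueness, replacing `Θ` by `Θ ∘ (1 + f)`, with `f` of degree 2, adds `∂f` to `μ` on `a₋`
(`shift_quad`). Equal classes can therefore be arranged to have equal representatives on `a₋`. The
rest of the bracket is then forced, because the degree-zero subalgebra acts faithfully on `S`. For
`x` in `V` and `s` in `S`, the degree-2 identity on `A, x, s` determines `[s, μ(A, x)]`, hence `μ(A,
x)` (`quad_left_unique`). For `x, y` in `V`, the degree-4 identity on `x, y, s` expresses `[ρ(x, y),
s]` through `μ`, hence determines `ρ` (`quart_unique`). With equal transported brackets, composing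
one identification with the inverse of the other is an isomorphism of filtered Lie superalgebras.

Faithfulness comes from the Clifford relation: if `σ(A) = 0`, then `Av`, as the commutator of `σ(A)`
with `v`, acts by zero on `S`, and a vector acting by zero on a nonzero Clifford module vanishes. -/

noncomputable section

/-! ### Parity decomposition -/

namespace LieSuperalgebra

variable {L : Type*} [AddCommGroup L] [Module ℝ L] (g : LieSuperalgebra L)

theorem eq_zero_of_mem_part {i j : ZMod 2} (hij : i ≠ j) {x : L} (hi : x ∈ g.part i)
    (hj : x ∈ g.part j) : x = 0 :=
  (Submodule.disjoint_def.1 (g.part_internal.submodule_iSupIndep.pairwiseDisjoint hij)) x hi hj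

theorem exists_even_add_odd (x : L) : ∃ y ∈ g.part 0, ∃ z ∈ g.part 1, x = y + z := by
  have hx : x ∈ ⨆ e, g.part e := g.part_internal.submodule_iSup_eq_top ▸ Submodule.mem_top
  have : (⨆ e, g.part e) ≤ g.part 0 ⊔ g.part 1 := by
    refine iSup_le fun e => ?_
    rcases (by decide : ∀ e : ZMod 2, e = 0 ∨ e = 1) e with rfl | rfl
    · exact le_sup_left
    · exact le_sup_right
  obtain ⟨y, hy, z, hz, h⟩ := Submodule.mem_sup.1 (this hx)
  exact ⟨y, hy, z, hz, h.symm⟩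

/-- A linear equivalence of super vector spaces that preserves parities also reflects them. -/
theorem mem_part_of_map {K : Type*} [AddCommGroup K] [Module ℝ K] (a : LieSuperalgebra K)
    (f : K ≃ₗ[ℝ] L) (hf : ∀ e x, x ∈ a.part e → f x ∈ g.part e) {e : ZMod 2} {x : K}
    (hx : f x ∈ g.part e) : x ∈ a.part e := by
  obtain ⟨y, hy, z, hz, rfl⟩ := a.exists_even_add_odd x
  rw [map_add] at hx
  rcases (by decide : ∀ e : ZMod 2, e = 0 ∨ e = 1) e with rfl | rfl
  · have h : f z ∈ g.part 0 := by simpa using sub_mem hx (hf 0 y hy)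
    have : z = 0 := f.map_eq_zero_iff.1 (g.eq_zero_of_mem_part (by decide) h (hf 1 z hz))
    simpa [this] using hy
  · have h : f y ∈ g.part 1 := by simpa using sub_mem hx (hf 1 z hz)
    have : y = 0 := f.map_eq_zero_iff.1 (g.eq_zero_of_mem_part (by decide) (hf 0 y hy) h)
    simpa [this] using hz

end LieSuperalgebra

/-! ### Homogeneous components and gradings concentrated in degrees -2, -1, 0 -/

namespace GradedLieSuperalgebra

variable {K : Type*} [AddCommGroup K] [Module ℝ K] (a : GradedLieSuperalgebra K)

theorem proj_mem (i : ℤ) (x : K) : a.proj i x ∈ a.deg i := Subtype.prop _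

theorem proj_of_mem {i : ℤ} {x : K} (hx : x ∈ a.deg i) : a.proj i x = x := by
  simp [proj, a.decomp_of_mem hx, DirectSum.component.lof_self]

theorem proj_of_mem_ne {i j : ℤ} (hij : i ≠ j) {x : K} (hx : x ∈ a.deg i) : a.proj j x = 0 := by
  simp [proj, a.decomp_of_mem hx, DirectSum.component.of, hij]

theorem eq_zero_of_proj {x : K} (h : ∀ i, a.proj i x = 0) : x = 0 := by
  refine a.decomp.map_eq_zero_iff.1 (DFinsupp.ext fun i => Subtype.ext ?_)
  exact h i

/-- The components of distinct degrees `n + 2`, …, `n + 8` are linearly independent. -/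
theorem eq_zero_of_add_eq_zero {n : ℤ} {u v w t : K} (hu : u ∈ a.deg (n + 2))
    (hv : v ∈ a.deg (n + 4)) (hw : w ∈ a.deg (n + 6)) (ht : t ∈ a.deg (n + 8))
    (h : u + v + w + t = 0) : u = 0 ∧ v = 0 := by
  have h2 := congrArg (a.proj (n + 2)) h
  have h4 := congrArg (a.proj (n + 4)) h
  rw [map_add, map_add, map_add, map_zero] at h2 h4
  rw [a.proj_of_mem hu, a.proj_of_mem_ne (by omega) hv, a.proj_of_mem_ne (by omega) hw,
    a.proj_of_mem_ne (by omega) ht] at h2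
  rw [a.proj_of_mem hv, a.proj_of_mem_ne (by omega) hu, a.proj_of_mem_ne (by omega) hw,
    a.proj_of_mem_ne (by omega) ht] at h4
  exact ⟨by simpa using h2, by simpa using h4⟩

/-- Induction on homogeneous elements. -/
theorem homogeneous_induction {p : K → Prop} (h0 : p 0) (hadd : ∀ x y, p x → p y → p (x + y))
    (h : ∀ i x, x ∈ a.deg i → p x) (x : K) : p x := by
  have hx : x ∈ ⨆ i, a.deg i := a.deg_internal.submodule_iSup_eq_top ▸ Submodule.mem_top
  exact Submodule.iSup_induction _ (motive := p) hx h h0 hadd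

theorem bilin_ext {M : Type*} [AddCommGroup M] [Module ℝ M] {B C : K →ₗ[ℝ] K →ₗ[ℝ] M}
    (h : ∀ i j x y, x ∈ a.deg i → y ∈ a.deg j → B x y = C x y) : B = C := by
  ext x y
  refine a.homogeneous_induction (p := fun x => B x y = C x y) (by simp)
    (fun x x' h h' => by simp [h, h']) (fun i x hx => ?_) x
  refine a.homogeneous_induction (p := fun y => B x y = C x y) (by simp)
    (fun y y' h h' => by simp [h, h']) (fun j y hy => h i j x y hx hy) y

/-- The grading is concentrated in the degrees `-2`, `-1` and `0`. -/
def IsTwoStep : Prop := ∀ i : ℤ, i < -2 ∨ 0 < i → a.deg i = ⊥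

/-- The subalgebra of degree `0` acts faithfully on the component of degree `-1`. -/
def IsTransitive : Prop :=
  ∀ A ∈ a.deg 0, (∀ s ∈ a.deg (-1), a.bracket A s = 0) → A = 0

variable {a}

theorem IsTwoStep.eq_zero (h : a.IsTwoStep) {i : ℤ} (hi : i < -2 ∨ 0 < i) {x : K}
    (hx : x ∈ a.deg i) : x = 0 := by
  rwa [h i hi, Submodule.mem_bot] at hx

theorem IsTwoStep.sum_proj (h : a.IsTwoStep) (x : K) :
    a.proj (-2) x + a.proj (-1) x + a.proj 0 x = x := by
  refine a.homogeneous_induction (p := fun x => a.proj (-2) x + a.proj (-1) x + a.proj 0 x = x)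
    (by simp) (fun x y hx hy => ?_) (fun i x hx => ?_) x
  · conv_rhs => rw [← hx, ← hy]
    simp only [map_add]
    abel
  · by_cases h2 : i = -2
    · subst h2
      simp [a.proj_of_mem hx, a.proj_of_mem_ne (show (-2 : ℤ) ≠ -1 by decide) hx,
        a.proj_of_mem_ne (show (-2 : ℤ) ≠ 0 by decide) hx]
    by_cases h1 : i = -1
    · subst h1
      simp [a.proj_of_mem hx, a.proj_of_mem_ne (show (-1 : ℤ) ≠ -2 by decide) hx,
        a.proj_of_mem_ne (show (-1 : ℤ) ≠ 0 by decide) hx]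
    by_cases h0 : i = 0
    · subst h0
      simp [a.proj_of_mem hx, a.proj_of_mem_ne (show (0 : ℤ) ≠ -2 by decide) hx,
        a.proj_of_mem_ne (show (0 : ℤ) ≠ -1 by decide) hx]
    · simp [h.eq_zero (by omega) hx]

theorem IsTwoStep.proj_eq_zero (h : a.IsTwoStep) {i : ℤ} (hi : i < -2 ∨ 0 < i) (x : K) :
    a.proj i x = 0 := h.eq_zero hi (a.proj_mem i x)

/-- The components of a homogeneous element for the parity have the same parity. -/
theorem IsTwoStep.proj_eq_zero_of_part (h : a.IsTwoStep) {e : ZMod 2} {x : K} (hx : x ∈ a.part e)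
    {i : ℤ} (hi : (i : ZMod 2) ≠ e) : a.proj i x = 0 := by
  by_cases hr : i < -2 ∨ 0 < i
  · exact h.proj_eq_zero hr x
  -- Degrees -2 and 0 are even and -1 is odd. The components of the wrong parity therefore add up to
  -- an element lying in both parts, which is zero; two even components are then separated by
  -- degree.
  have m2 : a.proj (-2) x ∈ a.part 0 := by
    simpa using (show ((-2 : ℤ) : ZMod 2) = 0 by decide) ▸ a.deg_le_part (-2) (a.proj_mem _ x)
  have m1 : a.proj (-1) x ∈ a.part 1 := by
    simpa using (show ((-1 : ℤ) : ZMod 2) = 1 by decide) ▸ a.deg_le_part (-1) (a.proj_mem _ x)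
  have m0 : a.proj 0 x ∈ a.part 0 := by simpa using a.deg_le_part 0 (a.proj_mem _ x)
  have hs := h.sum_proj x
  have hi' : i = -2 ∨ i = -1 ∨ i = 0 := by omega
  rcases (by decide : ∀ e : ZMod 2, e = 0 ∨ e = 1) e with rfl | rfl
  · have : i = -1 := by
      rcases hi' with rfl | rfl | rfl
      · exact absurd rfl hi
      · rfl
      · exact absurd (by simp) hi
    subst this
    refine a.eq_zero_of_mem_part (show (0 : ZMod 2) ≠ 1 by decide) ?_ m1
    have e : a.proj (-1) x = x - a.proj (-2) x - a.proj 0 x := by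
      conv_rhs => arg 1; arg 1; rw [← hs]
      abel
    rw [e]
    exact sub_mem (sub_mem hx m2) m0
  · have e : a.proj (-2) x + a.proj 0 x = x - a.proj (-1) x := by
      conv_rhs => arg 1; rw [← hs]
      abel
    have z : a.proj (-2) x + a.proj 0 x = 0 :=
      a.eq_zero_of_mem_part (by decide : (0 : ZMod 2) ≠ 1) (add_mem m2 m0) (e ▸ sub_mem hx m1)
    rcases hi' with rfl | rfl | rfl
    · have := congrArg (a.proj (-2)) z
      rwa [map_add, a.proj_of_mem (a.proj_mem _ x),
        a.proj_of_mem_ne (by decide) (a.proj_mem 0 x), add_zero, map_zero] at this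
    · exact absurd rfl hi
    · have := congrArg (a.proj 0) z
      rwa [map_add, a.proj_of_mem (a.proj_mem _ x),
        a.proj_of_mem_ne (by decide) (a.proj_mem (-2) x), zero_add, map_zero] at this

end GradedLieSuperalgebra

/-! ### Symbols, and existence of adapted identifications -/

namespace GrIso

variable {L K : Type*} [AddCommGroup L] [Module ℝ L] [AddCommGroup K] [Module ℝ K]
  {g : FilteredLieSuperalgebra L} {a : GradedLieSuperalgebra K} (φ : GrIso g a)

/-- The symbol of an element of the filtration. -/
def symb (i : ℤ) (x : L) (hx : x ∈ g.filt i) : K := φ.equiv i (g.grMk i ⟨x, hx⟩)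

theorem symb_mem (i : ℤ) (x : L) (hx : x ∈ g.filt i) : φ.symb i x hx ∈ a.deg i :=
  Subtype.prop _

theorem symb_eq_zero_iff (i : ℤ) (x : L) (hx : x ∈ g.filt i) :
    φ.symb i x hx = 0 ↔ x ∈ g.filt (i + 1) := by
  rw [symb, Submodule.coe_eq_zero, LinearEquiv.map_eq_zero_iff]
  exact Submodule.Quotient.mk_eq_zero _

theorem symb_sub (i : ℤ) (x y : L) (hx : x ∈ g.filt i) (hy : y ∈ g.filt i) :
    φ.symb i (x - y) (sub_mem hx hy) = φ.symb i x hx - φ.symb i y hy := by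
  rw [symb, symb, symb, ← Submodule.coe_sub, ← map_sub, ← map_sub]
  rfl

theorem symb_bracket (i j : ℤ) (x y : L) (hx : x ∈ g.filt i) (hy : y ∈ g.filt j) :
    φ.symb (i + j) (g.bracket x y) (g.filt_bracket_mem hx hy) =
      a.bracket (φ.symb i x hx) (φ.symb j y hy) := by
  rw [symb, symb, symb, ← φ.map_bracket, g.grBracket_mk]

/-- A missing graded piece means that the filtration does not drop there. Separatedness then gives
zero from degree 1 on (`filt_one`), and exhaustiveness gives everything from degree -2 down
(`mem_filt_neg_two`), so the filtration is finite. -/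
theorem filt_le_succ (φ : GrIso g a) (h : a.IsTwoStep) {i : ℤ} (hi : i < -2 ∨ 0 < i) :
    g.filt i ≤ g.filt (i + 1) :=
  fun x hx => (φ.symb_eq_zero_iff i x hx).1 (h.eq_zero hi (φ.symb_mem i x hx))

theorem filt_one (φ : GrIso g a) (h : a.IsTwoStep) {x : L} (hx : x ∈ g.filt 1) : x = 0 := by
  refine g.filt_separated x fun i => ?_
  rcases le_total i 1 with hi | hi
  · exact g.filt_antitone hi hx
  · induction i, hi using Int.leInduction with
    | base => exact hx
    | succ n hn ih => exact φ.filt_le_succ h (by omega) ih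

theorem mem_filt_neg_two (φ : GrIso g a) (h : a.IsTwoStep) (x : L) : x ∈ g.filt (-2) := by
  obtain ⟨i, hi⟩ := g.filt_exhaustive x
  rcases le_total i (-2) with h2 | h2
  · have : ∀ n : ℕ, x ∈ g.filt (-2 - n) → x ∈ g.filt (-2) := by
      intro n
      induction n with
      | zero => simp
      | succ n ih =>
        intro hx
        refine ih ?_
        have := φ.filt_le_succ h (by push_cast; omega) hx
        rwa [show -2 - ((n + 1 : ℕ) : ℤ) + 1 = -2 - n by push_cast; ring] at this
    refine this (-2 - i).toNat ?_
    rwa [show -2 - ((-2 - i).toNat : ℤ) = i by omega]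
  · exact g.filt_antitone h2 hi

/-- Descending induction along the filtration. -/
theorem filt_induction (φ : GrIso g a) (h : a.IsTwoStep) {p : ℤ → L → Prop} (h0 : ∀ i, p i 0)
    (hstep : ∀ i x, x ∈ g.filt i → (∀ y ∈ g.filt (i + 1), p (i + 1) y) → p i x)
    (i : ℤ) (x : L) (hx : x ∈ g.filt i) : p i x := by
  rcases le_total 1 i with hi | hi
  · rw [φ.filt_one h (g.filt_antitone hi hx)]
    exact h0 i
  -- The induction descends from degree 1, where the filtration is already zero.
  · have : ∀ n : ℕ, ∀ x ∈ g.filt (1 - n), p (1 - n) x := by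
      intro n
      induction n with
      | zero =>
        intro x hx
        have hx0 : x = 0 := φ.filt_one h (by simpa using hx)
        rw [hx0]
        exact h0 _
      | succ n ih =>
        intro x hx
        refine hstep _ x hx ?_
        rw [show 1 - ((n + 1 : ℕ) : ℤ) + 1 = 1 - n by push_cast; ring]
        exact ih
    have := this (1 - i).toNat x
    rw [show 1 - ((1 - i).toNat : ℤ) = i by omega] at this
    exact this hx

/-- A linear section is taken of the symbol map restricted to elements of parity `i` mod 2, which
makes the lift even. The restriction is still surjective because `φ` matches parities and degree `i`
lies in that part. -/
theorem exists_lift (i : ℤ) : ∃ s : ↥(a.deg i) →ₗ[ℝ] L,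
    ∀ x, s x ∈ g.part (i : ZMod 2) ∧ ∃ hx : s x ∈ g.filt i, φ.symb i (s x) hx = x := by
  let P : Submodule ℝ ↥(g.filt i) := (g.part (i : ZMod 2)).submoduleOf (g.filt i)
  let f : ↥P →ₗ[ℝ] ↥(a.deg i) := (φ.equiv i).toLinearMap ∘ₗ g.grMk i ∘ₗ P.subtype
  have hf : LinearMap.range f = ⊤ := by
    refine LinearMap.range_eq_top.2 fun y => ?_
    have hy : (φ.equiv i).symm y ∈ g.grPart i (i : ZMod 2) := by
      rw [φ.map_part, LinearEquiv.apply_symm_apply]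
      exact a.deg_le_part i y.2
    obtain ⟨z, hz, h⟩ := hy
    exact ⟨⟨z, hz⟩, by simp [f, h]⟩
  obtain ⟨s, hs⟩ := f.exists_rightInverse_of_surjective hf
  refine ⟨(g.filt i).subtype ∘ₗ P.subtype ∘ₗ s, fun x => ⟨(s x).2, (s x).1.2, ?_⟩⟩
  exact congrArg Subtype.val (LinearMap.congr_fun hs x)

/-- A lift of the graded space to the filtered one, degree by degree. -/
theorem exists_linear_lift : ∃ T : K →ₗ[ℝ] L, ∀ i x (_ : x ∈ a.deg i),
    T x ∈ g.part (i : ZMod 2) ∧ ∃ hx : T x ∈ g.filt i, φ.symb i (T x) hx = x := by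
  choose s hs using φ.exists_lift
  refine ⟨DirectSum.toModule ℝ ℤ L s ∘ₗ a.decomp.toLinearMap, fun i x hx => ?_⟩
  have e : (DirectSum.toModule ℝ ℤ L s ∘ₗ a.decomp.toLinearMap) x = s i ⟨x, hx⟩ := by
    simp [a.decomp_of_mem hx]
  rw [e]
  exact hs i ⟨x, hx⟩

/-- Successive approximation: subtracting the lift of the symbol of `y` moves the remainder one step
deeper, and the filtration is finite. -/
theorem lift_surjective (h : a.IsTwoStep) {T : K →ₗ[ℝ] L}
    (hT : ∀ i x, x ∈ a.deg i → ∃ hx : T x ∈ g.filt i, φ.symb i (T x) hx = x) (y : L) :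
    ∃ x, T x = y := by
  refine φ.filt_induction h (p := fun _ y => ∃ x, T x = y) (fun _ => ⟨0, map_zero _⟩)
    (fun i y hy ih => ?_) (-2) y (φ.mem_filt_neg_two h y)
  obtain ⟨h1, h2⟩ := hT i _ (φ.symb_mem i y hy)
  obtain ⟨x, hx⟩ := ih (y - T (φ.symb i y hy)) ((φ.symb_eq_zero_iff i _ (sub_mem hy h1)).1 (by
    rw [φ.symb_sub i _ _ hy h1, h2, sub_self]))
  exact ⟨x + φ.symb i y hy, by rw [map_add, hx, sub_add_cancel]⟩

theorem lift_mem_filt (h : a.IsTwoStep) {T : K →ₗ[ℝ] L}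
    (hT : ∀ i x, x ∈ a.deg i → T x ∈ g.filt i) {i : ℤ} {x : K}
    (hx : ∀ k < i, a.proj k x = 0) : T x ∈ g.filt i := by
  have : ∀ k, T (a.proj k x) ∈ g.filt i := by
    intro k
    rcases lt_or_ge k i with hk | hk
    · rw [hx k hk, map_zero]
      exact zero_mem _
    · exact g.filt_antitone hk (hT k _ (a.proj_mem k x))
  rw [← h.sum_proj x, map_add, map_add]
  exact add_mem (add_mem (this _) (this _)) (this _)

/-- The lowest component of `x` is the symbol of its lift, and it must vanish if `T x` lies deeper.
Together with `lift_mem_filt`, this reads the filtration off the grading; it also yields injectivity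
of `T`. -/
theorem proj_eq_zero_of_lift_mem (h : a.IsTwoStep) {T : K →ₗ[ℝ] L}
    (hT : ∀ i x, x ∈ a.deg i → ∃ hx : T x ∈ g.filt i, φ.symb i (T x) hx = x) {i : ℤ} {x : K}
    (hx : T x ∈ g.filt i) : ∀ k < i, a.proj k x = 0 := by
  have step : ∀ k, k < i → (∀ l < k, a.proj l x = 0) → a.proj k x = 0 := by
    intro k hk hl
    have hd : ∀ l < k + 1, a.proj l (x - a.proj k x) = 0 := by
      intro l hlk
      rcases eq_or_ne l k with rfl | hne
      · rw [map_sub, a.proj_of_mem (a.proj_mem _ x), sub_self]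
      · rw [map_sub, a.proj_of_mem_ne hne.symm (a.proj_mem _ x), hl l (by omega), sub_zero]
    have m := lift_mem_filt h (fun i x hx => (hT i x hx).1) hd
    obtain ⟨h1, h2⟩ := hT k _ (a.proj_mem k x)
    rw [← h2, φ.symb_eq_zero_iff]
    have := sub_mem (g.filt_antitone (show k + 1 ≤ i by omega) hx) m
    rwa [map_sub, sub_sub_cancel] at this
  -- The shift by 3 starts the induction just below the lowest degree -2, where every component is
  -- zero.
  have all : ∀ n : ℕ, (n : ℤ) - 3 < i → ∀ l : ℤ, l ≤ n - 3 → a.proj l x = 0 := by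
    intro n
    induction n with
    | zero => exact fun _ l hl => h.proj_eq_zero (by left; push_cast at hl; omega) x
    | succ n ih =>
      intro hn l hl
      push_cast at hn hl
      rcases eq_or_ne l (n + 1 - 3) with rfl | hne
      · exact step _ hn fun l hl => ih (by omega) l (by omega)
      · exact ih (by omega) l (by omega)
  intro k hk
  rcases lt_or_ge k (-3) with hk' | hk'
  · exact h.proj_eq_zero (by omega) x
  · exact all (k + 3).toNat (by omega) k (by omega)

theorem nonempty_splitting (h : a.IsTwoStep) : Nonempty (Splitting φ) := by
  obtain ⟨T, hT⟩ := φ.exists_linear_lift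
  have hT' := fun i x hx => (hT i x hx).2
  have inj : Function.Injective T := by
    refine (injective_iff_map_eq_zero T).2 fun x hx => a.eq_zero_of_proj fun i => ?_
    -- Zero lies in every step of the filtration, so each component of an element of the kernel
    -- vanishes.
    exact φ.proj_eq_zero_of_lift_mem h hT' (i := i + 1) (by rw [hx]; exact zero_mem _) i
      (by omega)
  refine ⟨⟨LinearEquiv.ofBijective T ⟨inj, φ.lift_surjective h hT'⟩, fun e x hx => ?_,
    fun i x hx => (hT' i x hx).1, fun i x hx => (hT' i x hx).2⟩⟩
  -- The lift is known to respect parity only on elements of a given degree; components whose degree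
  -- has the wrong parity vanish.
  have key : ∀ k : ℤ, T (a.proj k x) ∈ g.part e := by
    intro k
    by_cases hk : (k : ZMod 2) = e
    · exact hk ▸ (hT k _ (a.proj_mem k x)).1
    · rw [h.proj_eq_zero_of_part hx hk, map_zero]
      exact zero_mem _
  change T x ∈ g.part e
  rw [← h.sum_proj x, map_add, map_add]
  exact add_mem (add_mem (key _) (key _)) (key _)

end GrIso

/-! ### Jacobi expressions of graded bilinear maps -/

namespace GradedLieSuperalgebra

variable {K : Type*} [AddCommGroup K] [Module ℝ K] (a : GradedLieSuperalgebra K)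

theorem bilinComponent_mem (d : ℤ) (B : K →ₗ[ℝ] K →ₗ[ℝ] K) {i j : ℤ} {x y : K}
    (hx : x ∈ a.deg i) (hy : y ∈ a.deg j) : a.bilinComponent d B x y ∈ a.deg (i + j + d) := by
  rw [a.bilinComponent_apply d B hx hy]
  exact a.proj_mem _ _

/-- The Jacobi expression of two bilinear maps, with sign `ε`. -/
def jac (ε : ℝ) (P Q : K →ₗ[ℝ] K →ₗ[ℝ] K) (x y z : K) : K :=
  P x (Q y z) - P (Q x y) z - ε • P y (Q x z)

variable {a}

theorem jac_mem_deg {p q : ℤ} {P Q : K →ₗ[ℝ] K →ₗ[ℝ] K} (ε : ℝ)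
    (hP : ∀ i j x y, x ∈ a.deg i → y ∈ a.deg j → P x y ∈ a.deg (i + j + p))
    (hQ : ∀ i j x y, x ∈ a.deg i → y ∈ a.deg j → Q x y ∈ a.deg (i + j + q))
    {i j k r : ℤ} {x y z : K} (hr : i + j + k + p + q = r) (hx : x ∈ a.deg i) (hy : y ∈ a.deg j)
    (hz : z ∈ a.deg k) : jac ε P Q x y z ∈ a.deg r := by
  subst hr
  have h1 := hP _ _ _ _ hx (hQ _ _ _ _ hy hz)
  have h2 := hP _ _ _ _ (hQ _ _ _ _ hx hy) hz
  have h3 := hP _ _ _ _ hy (hQ _ _ _ _ hx hz)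
  rw [show i + (j + k + q) + p = i + j + k + p + q by ring] at h1
  rw [show i + j + q + k + p = i + j + k + p + q by ring] at h2
  rw [show j + (i + k + q) + p = i + j + k + p + q by ring] at h3
  exact sub_mem (sub_mem h1 h2) (Submodule.smul_mem _ _ h3)

theorem jac_add_left (ε : ℝ) (P P' Q : K →ₗ[ℝ] K →ₗ[ℝ] K) (x y z : K) :
    jac ε (P + P') Q x y z = jac ε P Q x y z + jac ε P' Q x y z := by
  simp only [jac, LinearMap.add_apply]
  module

theorem jac_add_right (ε : ℝ) (P Q Q' : K →ₗ[ℝ] K →ₗ[ℝ] K) (x y z : K) :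
    jac ε P (Q + Q') x y z = jac ε P Q x y z + jac ε P Q' x y z := by
  simp only [jac, LinearMap.add_apply, map_add]
  module

theorem jac_bracket {i j k : ZMod 2} {x y z : K} (hx : x ∈ a.part i) (hy : y ∈ a.part j)
    (hz : z ∈ a.part k) : jac (superSign i j) a.bracket a.bracket x y z = 0 := by
  rw [jac, a.jacobi hx hy hz]
  module

/-- Induction on homogeneous elements of a given parity. -/
theorem IsTwoStep.part_induction (h : a.IsTwoStep) {p : K → Prop}
    (hadd : ∀ x y, p x → p y → p (x + y)) {e : ZMod 2}
    (hd : ∀ (i : ℤ) x, (i : ZMod 2) = e → x ∈ a.deg i → p x) {x : K} (hx : x ∈ a.part e) : p x := by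
  -- Zero is homogeneous of every degree, so degree 0 or 1 serves, according to the parity.
  have h0 : p 0 := by
    rcases (by decide : ∀ e : ZMod 2, e = 0 ∨ e = 1) e with rfl | rfl
    · exact hd 0 0 (by simp) (zero_mem _)
    · exact hd 1 0 (by simp) (zero_mem _)
  have key : ∀ k : ℤ, p (a.proj k x) := by
    intro k
    by_cases hk : (k : ZMod 2) = e
    · exact hd k _ hk (a.proj_mem k x)
    · rw [h.proj_eq_zero_of_part hx hk]
      exact h0
  rw [← h.sum_proj x]
  exact hadd _ _ (hadd _ _ (key _) (key _)) (key _)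

end GradedLieSuperalgebra

open GradedLieSuperalgebra

/-! ### The transported bracket: cocycle condition and invariance -/

namespace Splitting

variable {L K : Type*} [AddCommGroup L] [Module ℝ L] [AddCommGroup K] [Module ℝ K]
  {g : FilteredLieSuperalgebra L} {a : GradedLieSuperalgebra K} {φ : GrIso g a}
  (Θ : Splitting φ)

theorem bracket_apply (x y : K) :
    Θ.bracket x y = Θ.equiv.symm (g.bracket (Θ.equiv x) (Θ.equiv y)) := rfl

theorem equiv_bracket (x y : K) :
    Θ.equiv (Θ.bracket x y) = g.bracket (Θ.equiv x) (Θ.equiv y) := by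
  rw [bracket_apply, LinearEquiv.apply_symm_apply]

theorem mem_part_iff {e : ZMod 2} {x : K} : Θ.equiv x ∈ g.part e ↔ x ∈ a.part e :=
  ⟨g.mem_part_of_map a.toLieSuperalgebra Θ.equiv Θ.map_part, Θ.map_part e x⟩

/-- The right-hand side does not involve `Θ`. Hence identifications of two deformations match their
filtrations, as `mem_part_iff` does for parities. -/
theorem mem_filt_iff (h : a.IsTwoStep) {i : ℤ} {x : K} :
    Θ.equiv x ∈ g.filt i ↔ ∀ k < i, a.proj k x = 0 :=
  ⟨φ.proj_eq_zero_of_lift_mem (T := Θ.equiv.toLinearMap) h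
    fun i x hx => ⟨Θ.map_deg i x hx, Θ.symbol i x hx⟩,
    GrIso.lift_mem_filt (T := Θ.equiv.toLinearMap) h Θ.map_deg⟩

theorem bracket_mem_part {i j : ZMod 2} {x y : K} (hx : x ∈ a.part i) (hy : y ∈ a.part j) :
    Θ.bracket x y ∈ a.part (i + j) := by
  rw [← Θ.mem_part_iff, equiv_bracket]
  exact g.bracket_mem (Θ.map_part i x hx) (Θ.map_part j y hy)

theorem bracket_skew {i j : ZMod 2} {x y : K} (hx : x ∈ a.part i) (hy : y ∈ a.part j) :
    Θ.bracket x y = -(superSign i j • Θ.bracket y x) := by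
  rw [bracket_apply, g.skew (Θ.map_part i x hx) (Θ.map_part j y hy), map_neg, map_smul,
    bracket_apply]

theorem jac_bracket {i j k : ZMod 2} {x y z : K} (hx : x ∈ a.part i) (hy : y ∈ a.part j)
    (hz : z ∈ a.part k) : jac (superSign i j) Θ.bracket Θ.bracket x y z = 0 := by
  apply Θ.equiv.injective
  simp only [jac, map_sub, map_smul, equiv_bracket, map_zero]
  rw [g.jacobi (Θ.map_part i x hx) (Θ.map_part j y hy) (Θ.map_part k z hz)]
  module

/-- The component of degree `2` of the transported bracket. -/
def quad : K →ₗ[ℝ] K →ₗ[ℝ] K := a.bilinComponent 2 Θ.bracket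

/-- The component of degree `4` of the transported bracket. -/
def quart : K →ₗ[ℝ] K →ₗ[ℝ] K := a.bilinComponent 4 Θ.bracket

theorem mu_apply (x y : ↥a.neg) : Θ.mu x y = Θ.quad x y := rfl

theorem quad_mem_deg (i j : ℤ) (x y : K) (hx : x ∈ a.deg i) (hy : y ∈ a.deg j) :
    Θ.quad x y ∈ a.deg (i + j + 2) := a.bilinComponent_mem 2 _ hx hy

theorem quart_mem_deg (i j : ℤ) (x y : K) (hx : x ∈ a.deg i) (hy : y ∈ a.deg j) :
    Θ.quart x y ∈ a.deg (i + j + 4) := a.bilinComponent_mem 4 _ hx hy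

/-- The summand `+ 0` lets the bracket of `a` enter `jac_mem_deg` as a map of degree 0. -/
theorem _root_.GradedLieSuperalgebra.bracket_mem_deg (a : GradedLieSuperalgebra K) (i j : ℤ) (x y : K) (hx : x ∈ a.deg i)
    (hy : y ∈ a.deg j) : a.bracket x y ∈ a.deg (i + j + 0) := by
  rw [add_zero]
  exact a.deg_bracket_mem hx hy

/-- Both brackets have the same symbol in degree `i + j`, because `φ` respects brackets and `Θ`
induces its inverse; so their difference lies one filtration step deeper. -/
theorem bracket_sub_mem {i j : ℤ} {x y : K} (h : a.IsTwoStep) (hx : x ∈ a.deg i)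
    (hy : y ∈ a.deg j) : ∀ k < i + j + 1, a.proj k (Θ.bracket x y - a.bracket x y) = 0 := by
  rw [← Θ.mem_filt_iff h, map_sub, equiv_bracket]
  have hb := a.deg_bracket_mem hx hy
  have h1 := φ.symb_bracket i j _ _ (Θ.map_deg i x hx) (Θ.map_deg j y hy)
  have h2 : φ.symb (i + j) _ (Θ.map_deg _ _ hb) = a.bracket x y := Θ.symbol _ _ hb
  have e1 : φ.symb i _ (Θ.map_deg i x hx) = x := Θ.symbol _ _ hx
  have e2 : φ.symb j _ (Θ.map_deg j y hy) = y := Θ.symbol _ _ hy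
  have m := g.filt_bracket_mem (Θ.map_deg i x hx) (Θ.map_deg j y hy)
  rw [← φ.symb_eq_zero_iff (i + j) _ (sub_mem m (Θ.map_deg _ _ hb)),
    φ.symb_sub _ _ _ m (Θ.map_deg _ _ hb), h1, h2, e1, e2, sub_self]

/-- The transported bracket only has components of degree `0`, `2` and `4`, and its component
of degree `0` is the bracket of `a`. -/
theorem bracket_eq (h : a.IsTwoStep) : Θ.bracket = a.bracket + Θ.quad + Θ.quart := by
  refine a.bilin_ext fun i j x y hx hy => ?_
  by_cases hi : i < -2 ∨ 0 < i
  · simp [h.eq_zero hi hx]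
  by_cases hj : j < -2 ∨ 0 < j
  · simp [h.eq_zero hj hy]
  set D := Θ.bracket x y - a.bracket x y with hD
  have low := Θ.bracket_sub_mem h hx hy
  have par : D ∈ a.part ((i + j : ℤ) : ZMod 2) := by
    have h1 := Θ.bracket_mem_part (a.deg_le_part i hx) (a.deg_le_part j hy)
    rw [← Int.cast_add] at h1
    exact sub_mem h1 (a.deg_le_part _ (a.deg_bracket_mem hx hy))
  have odd : a.proj (i + j + 1) D = 0 ∧ a.proj (i + j + 3) D = 0 := by
    constructor <;> refine h.proj_eq_zero_of_part par ?_ <;>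
      rw [Ne, ZMod.intCast_eq_intCast_iff_dvd_sub] <;> omega
  have comp : ∀ d, d ≠ 0 → a.bilinComponent d Θ.bracket x y = a.proj (i + j + d) D := by
    intro d hd
    rw [a.bilinComponent_apply d _ hx hy, hD, map_sub,
      a.proj_of_mem_ne (by omega) (a.deg_bracket_mem hx hy), sub_zero]
  have key : D = a.proj (i + j + 2) D + a.proj (i + j + 4) D := by
    refine sub_eq_zero.1 (a.eq_zero_of_proj fun k => ?_)
    rw [map_sub, map_add]
    by_cases h2 : k = i + j + 2
    · rw [h2, a.proj_of_mem (a.proj_mem _ D), a.proj_of_mem_ne (by omega) (a.proj_mem _ D)]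
      simp
    by_cases h4 : k = i + j + 4
    · rw [h4, a.proj_of_mem (a.proj_mem _ D), a.proj_of_mem_ne (by omega) (a.proj_mem _ D)]
      simp
    -- Components below `i + j + 1` vanish by the symbol, those at offsets 1 and 3 by parity, and
    -- those at offset 5 or more because `i, j ≥ -2` puts them in positive degree.
    have hk : a.proj k D = 0 := by
      rcases lt_or_ge k (i + j + 1) with hlt | hge
      · exact low k hlt
      by_cases h1 : k = i + j + 1
      · rw [h1, odd.1]
      by_cases h3 : k = i + j + 3
      · rw [h3, odd.2]
      exact h.proj_eq_zero (by omega) D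
    rw [hk, a.proj_of_mem_ne (Ne.symm h2) (a.proj_mem _ D),
      a.proj_of_mem_ne (Ne.symm h4) (a.proj_mem _ D)]
    simp
  rw [LinearMap.add_apply, LinearMap.add_apply, LinearMap.add_apply, LinearMap.add_apply,
    quad, quart, comp 2 (by decide), comp 4 (by decide), add_assoc, ← key, hD]
  abel

/-- Expanding the Jacobi identity along `bracket_eq` gives terms of degrees 0, 2, 4, 6, 8. The
degree-0 term is the Jacobi identity of `a`; the others vanish separately, and only degrees 2 and 4
are needed. -/
theorem jac_bracket_deg (h : a.IsTwoStep) {i j k : ℤ} {x y z : K} (hx : x ∈ a.deg i)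
    (hy : y ∈ a.deg j) (hz : z ∈ a.deg k) (ε : ℝ) (hε : ε = superSign (i : ZMod 2) (j : ZMod 2)) :
    jac ε a.bracket Θ.quad x y z + jac ε Θ.quad a.bracket x y z = 0 ∧
    jac ε a.bracket Θ.quart x y z + jac ε Θ.quart a.bracket x y z
      + jac ε Θ.quad Θ.quad x y z = 0 := by
  have px := a.deg_le_part i hx
  have py := a.deg_le_part j hy
  have pz := a.deg_le_part k hz
  have J := Θ.jac_bracket px py pz
  have J0 := GradedLieSuperalgebra.jac_bracket px py pz
  rw [← hε] at J J0
  rw [Θ.bracket_eq h] at J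
  simp only [jac_add_left, jac_add_right, J0] at J
  have b0 := a.bracket_mem_deg
  have b2 := Θ.quad_mem_deg
  have b4 := Θ.quart_mem_deg
  refine a.eq_zero_of_add_eq_zero (n := i + j + k)
    (add_mem (jac_mem_deg ε b0 b2 (by ring) hx hy hz) (jac_mem_deg ε b2 b0 (by ring) hx hy hz))
    (add_mem (add_mem (jac_mem_deg ε b0 b4 (by ring) hx hy hz)
      (jac_mem_deg ε b4 b0 (by ring) hx hy hz)) (jac_mem_deg ε b2 b2 (by ring) hx hy hz))
    (add_mem (jac_mem_deg ε b2 b4 (by ring) hx hy hz) (jac_mem_deg ε b4 b2 (by ring) hx hy hz))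
    (jac_mem_deg ε b4 b4 (by ring) hx hy hz) ?_
  rw [← J]
  abel

theorem quad_mem_part (h : a.IsTwoStep) {i j : ZMod 2} {x y : K} (hx : x ∈ a.part i)
    (hy : y ∈ a.part j) : Θ.quad x y ∈ a.part (i + j) := by
  refine h.part_induction (p := fun x => Θ.quad x y ∈ a.part (i + j)) (fun x x' h h' => ?_)
    (fun m x hm hx => ?_) hx
  · rw [map_add, LinearMap.add_apply]
    exact add_mem h h'
  refine h.part_induction (p := fun y => Θ.quad x y ∈ a.part (i + j)) (fun y y' h h' => ?_)
    (fun n y hn hy => ?_) hy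
  · rw [map_add]
    exact add_mem h h'
  have e : ((m + n + 2 : ℤ) : ZMod 2) = i + j := by
    rw [← hm, ← hn]
    push_cast
    rw [show (2 : ZMod 2) = 0 by decide, add_zero]
  exact e ▸ a.deg_le_part _ (Θ.quad_mem_deg m n x y hx hy)

theorem quad_skew (h : a.IsTwoStep) {i j : ZMod 2} {x y : K} (hx : x ∈ a.part i)
    (hy : y ∈ a.part j) : Θ.quad x y = -(superSign i j • Θ.quad y x) := by
  refine h.part_induction (p := fun x => Θ.quad x y = -(superSign i j • Θ.quad y x))
    (fun x x' h h' => ?_) (fun m x hm dx => ?_) hx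
  · simp only [map_add, LinearMap.add_apply, h, h']
    module
  refine h.part_induction (p := fun y => Θ.quad x y = -(superSign i j • Θ.quad y x))
    (fun y y' h h' => ?_) (fun n y hn dy => ?_) hy
  · simp only [map_add, LinearMap.add_apply, h, h']
    module
  subst hm hn
  rw [quad, a.bilinComponent_apply 2 _ dx dy, a.bilinComponent_apply 2 _ dy dx, add_comm n m,
    Θ.bracket_skew (a.deg_le_part m dx) (a.deg_le_part n dy), map_neg, map_smul]

/-- The degree-2 identity is trilinear and its sign depends only on parities, so it passes from
elements of given degree to elements of given parity, as the cocycle condition requires. -/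
theorem jac_quad (h : a.IsTwoStep) {i j k : ZMod 2} {x y z : K} (hx : x ∈ a.part i)
    (hy : y ∈ a.part j) (hz : z ∈ a.part k) :
    jac (superSign i j) a.bracket Θ.quad x y z + jac (superSign i j) Θ.quad a.bracket x y z
      = 0 := by
  have add3 : ∀ {u v u' v' w w' : K}, u + v = 0 → u' + v' = 0 → w = u + u' → w' = v + v' →
      w + w' = 0 := by
    rintro u v u' v' w w' h1 h2 rfl rfl
    rw [add_add_add_comm, h1, h2, add_zero]
  refine h.part_induction (p := fun x => jac (superSign i j) a.bracket Θ.quad x y z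
    + jac (superSign i j) Θ.quad a.bracket x y z = 0)
    (fun x x' h h' => add3 h h' ?_ ?_) (fun l x hl dx => ?_) hx
  · simp only [jac, map_add, LinearMap.add_apply]; module
  · simp only [jac, map_add, LinearMap.add_apply]; module
  refine h.part_induction (p := fun y => jac (superSign i j) a.bracket Θ.quad x y z
    + jac (superSign i j) Θ.quad a.bracket x y z = 0)
    (fun y y' h h' => add3 h h' ?_ ?_) (fun m y hm dy => ?_) hy
  · simp only [jac, map_add, LinearMap.add_apply]; module
  · simp only [jac, map_add, LinearMap.add_apply]; module
  refine h.part_induction (p := fun z => jac (superSign i j) a.bracket Θ.quad x y z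
    + jac (superSign i j) Θ.quad a.bracket x y z = 0)
    (fun z z' h h' => add3 h h' ?_ ?_) (fun n z _ dz => ?_) hz
  · simp only [jac, map_add]; module
  · simp only [jac, map_add]; module
  subst hl hm
  exact (Θ.jac_bracket_deg h dx dy dz _ rfl).1

theorem mu_mem_cocycles (h : a.IsTwoStep) : Θ.mu ∈ a.cocycles₂ 2 := by
  refine ⟨⟨fun i j x y hx hy => Θ.quad_mem_deg i j x y hx hy,
    fun i j x y hx hy => Θ.quad_skew h hx hy⟩, fun i j k x y z hx hy hz => ?_⟩
  have J := Θ.jac_quad h hx hy hz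
  have c : ∀ x y : ↥a.neg, ((a.negBracket x y : ↥a.neg) : K) = a.bracket x y := fun _ _ => rfl
  simp only [spencer₂, mu_apply, c]
  -- Skew-symmetry turns the cyclic form of the Spencer differential into the Leibniz form of
  -- `jac_quad`; the remaining signs are compared for each choice of parities.
  rw [Θ.quad_skew h hz hx, a.skew hz (Θ.quad_mem_part h hx hy),
    Θ.quad_skew h (a.bracket_mem hy hz) hx, a.skew hz hx]
  simp only [map_neg, map_smul, LinearMap.neg_apply, LinearMap.smul_apply]
  rw [Θ.quad_skew h (a.bracket_mem hx hz) hy, ← J]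
  simp only [jac]
  rcases (by decide : ∀ e : ZMod 2, e = 0 ∨ e = 1) i with rfl | rfl <;>
  rcases (by decide : ∀ e : ZMod 2, e = 0 ∨ e = 1) j with rfl | rfl <;>
  rcases (by decide : ∀ e : ZMod 2, e = 0 ∨ e = 1) k with rfl | rfl <;>
  simp only [add_zero, zero_add, show (1 + 1 : ZMod 2) = 0 by decide, superSign_zero_left,
    superSign_zero_right, superSign_one_one] <;>
  module

/-- For `A` of degree `0`, the action of `A` on the component of degree `2` of the bracket is the
differential of its contraction with `A`. -/
theorem act_quad (h : a.IsTwoStep) {A : K} (hA : A ∈ a.deg 0) {i j : ZMod 2} {x y : K}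
    (hx : x ∈ a.part i) (hy : y ∈ a.part j) :
    a.bracket A (Θ.quad x y) - Θ.quad (a.bracket A x) y - Θ.quad x (a.bracket A y) =
      a.bracket x (Θ.quad A y) - superSign i j • a.bracket y (Θ.quad A x)
        - Θ.quad A (a.bracket x y) := by
  have pA := a.mem_part_zero hA
  have J := Θ.jac_quad h pA hx hy
  simp only [jac, superSign_zero_left, one_smul] at J
  have m := Θ.quad_mem_part h pA hx
  rw [zero_add] at m
  rw [a.skew m hy] at J
  rw [← sub_eq_zero, ← J]
  module

theorem isInvariantClass_mu (h : a.IsTwoStep) (hμ : Θ.mu ∈ a.cocycles₂ 2) :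
    a.IsInvariantClass 2 (a.cohClass 2 ⟨Θ.mu, hμ⟩) := by
  intro A
  refine (Submodule.Quotient.mk_eq_zero _).2 ?_
  -- The primitive of `A · μ` is the contraction `μ(A, -)`, of degree 2 because `A` has degree 0.
  refine ⟨(Θ.quad A).domRestrict a.neg, fun i x hx => ?_,
    fun i j x y hx hy => Θ.act_quad h A.2 hx hy⟩
  have := Θ.quad_mem_deg 0 i A x A.2 hx
  rwa [zero_add] at this

end Splitting

/-! ### Maps of degree 2 and the automorphisms `1 + f` -/

namespace GradedLieSuperalgebra

variable {K : Type*} [AddCommGroup K] [Module ℝ K] {a : GradedLieSuperalgebra K}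

/-- Two applications raise the degree by 4, more than the length of the grading. Hence `1 - f`
inverts `1 + f`. -/
theorem IsTwoStep.comp_self (h : a.IsTwoStep) {f : K →ₗ[ℝ] K}
    (hf : ∀ i x, x ∈ a.deg i → f x ∈ a.deg (i + 2)) (x : K) : f (f x) = 0 := by
  refine a.homogeneous_induction (p := fun x => f (f x) = 0) (by simp)
    (fun x y hx hy => by simp [hx, hy]) (fun i x hx => ?_) x
  by_cases hi : i < -2
  · simp [h.eq_zero (Or.inl hi) hx]
  · exact h.eq_zero (by omega) (hf _ _ (hf i x hx))

/-- The automorphism `1 + f` of the vector space `a` given by a map `f` of degree `2`. -/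
def IsTwoStep.shift (h : a.IsTwoStep) (f : K →ₗ[ℝ] K)
    (hf : ∀ i x, x ∈ a.deg i → f x ∈ a.deg (i + 2)) : K ≃ₗ[ℝ] K :=
  LinearEquiv.ofLinearMap (LinearMap.id + f) (LinearMap.id - f)
    (by ext x; simp [h.comp_self hf]) (by ext x; simp [h.comp_self hf])

theorem IsTwoStep.shift_apply (h : a.IsTwoStep) (f : K →ₗ[ℝ] K)
    (hf : ∀ i x, x ∈ a.deg i → f x ∈ a.deg (i + 2)) (x : K) : h.shift f hf x = x + f x := rfl

/-- A `1`-cochain of degree `2`, extended to the whole of `a`. -/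
def extend (a : GradedLieSuperalgebra K) (ψ : ↥a.neg →ₗ[ℝ] K) : K →ₗ[ℝ] K :=
  ψ ∘ₗ (a.proj (-2)).codRestrict a.neg
    fun x => a.deg_le_neg (by decide : (-2 : ℤ) < 0) (a.proj_mem (-2) x)

theorem extend_mem {ψ : ↥a.neg →ₗ[ℝ] K} (hψ : ψ ∈ a.cochains₁ 2)
    (i : ℤ) (x : K) (hx : x ∈ a.deg i) : a.extend ψ x ∈ a.deg (i + 2) := by
  by_cases hi : i = -2
  · subst hi
    exact hψ (-2) _ (a.proj_mem (-2) x)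
  · have : (a.proj (-2)).codRestrict a.neg (fun x => a.deg_le_neg (by decide : (-2 : ℤ) < 0)
        (a.proj_mem (-2) x)) x = 0 := Subtype.ext (a.proj_of_mem_ne hi hx)
    rw [extend, LinearMap.comp_apply, this, map_zero]
    exact zero_mem _

/-- Nothing is lost by keeping only the component of degree -2: a map of degree 2 sends degree -1 to
degree 1, which is zero. -/
theorem IsTwoStep.extend_apply (h : a.IsTwoStep) {ψ : ↥a.neg →ₗ[ℝ] K} (hψ : ψ ∈ a.cochains₁ 2)
    {i : ℤ} (x : ↥a.neg) (hx : (x : K) ∈ a.deg i) : a.extend ψ x = ψ x := by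
  by_cases hi : i = -2
  · subst hi
    exact congrArg ψ (Subtype.ext (a.proj_of_mem hx))
  by_cases hi' : i < -2
  · have : x = 0 := Subtype.ext (h.eq_zero (Or.inl hi') hx)
    simp [this]
  · rw [h.eq_zero (by omega) (extend_mem hψ i x hx), h.eq_zero (by omega) (hψ i x hx)]

end GradedLieSuperalgebra

/-! ### Change of the adapted identification -/

namespace Splitting

variable {L K : Type*} [AddCommGroup L] [Module ℝ L] [AddCommGroup K] [Module ℝ K]
  {g : FilteredLieSuperalgebra L} {a : GradedLieSuperalgebra K} {φ : GrIso g a}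
  (Θ : Splitting φ)

/-- The adapted identification `Θ ∘ (1 + f)`, for a map `f` of degree `2`. -/
def shift (h : a.IsTwoStep) (f : K →ₗ[ℝ] K) (hf : ∀ i x, x ∈ a.deg i → f x ∈ a.deg (i + 2)) :
    Splitting φ where
  equiv := h.shift f hf ≪≫ₗ Θ.equiv
  map_part e x hx := by
    refine Θ.map_part e _ (add_mem hx ?_)
    refine h.part_induction (p := fun x => f x ∈ a.part e) (fun x y h h' => ?_)
      (fun i x hi hx => ?_) hx
    · rw [map_add]
      exact add_mem h h'
    · have e2 : ((i + 2 : ℤ) : ZMod 2) = e := by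
        push_cast
        rw [hi, show (2 : ZMod 2) = 0 by decide, add_zero]
      exact e2 ▸ a.deg_le_part _ (hf i x hx)
  map_deg i x hx := by
    rw [LinearEquiv.trans_apply, h.shift_apply, map_add]
    exact add_mem (Θ.map_deg i x hx)
      (g.filt_antitone (by omega) (Θ.map_deg (i + 2) _ (hf i x hx)))
  symbol i x hx := by
    have m1 := Θ.map_deg i x hx
    have m2 : Θ.equiv (f x) ∈ g.filt (i + 1) :=
      g.filt_antitone (by omega) (Θ.map_deg (i + 2) _ (hf i x hx))
    have e : Θ.equiv (x + f x) = Θ.equiv x + Θ.equiv (f x) := map_add _ _ _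
    have m : Θ.equiv (x + f x) ∈ g.filt i :=
      e ▸ add_mem m1 (g.filt_antitone (by omega) m2)
    -- The correction `f x` lies two steps deeper, so the symbol does not change.
    have s := φ.symb_sub i _ _ m m1
    rw [(φ.symb_eq_zero_iff i _ (sub_mem m m1)).2 (by rwa [e, add_sub_cancel_left])] at s
    exact (sub_eq_zero.1 s.symm).trans (Θ.symbol i x hx)

/-- The factor `1 + f` stays on the side of the new bracket, so that its inverse does not enter the
comparison of degrees. -/
theorem shift_bracket (h : a.IsTwoStep) (f : K →ₗ[ℝ] K)
    (hf : ∀ i x, x ∈ a.deg i → f x ∈ a.deg (i + 2)) (x y : K) :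
    (Θ.shift h f hf).bracket x y + f ((Θ.shift h f hf).bracket x y) =
      Θ.bracket (x + f x) (y + f y) := by
  apply Θ.equiv.injective
  rw [equiv_bracket]
  exact (Θ.shift h f hf).equiv_bracket x y

/-- The change of the component of degree `2` of the bracket under a change of the adapted
identification. -/
theorem shift_quad (h : a.IsTwoStep) (f : K →ₗ[ℝ] K)
    (hf : ∀ i x, x ∈ a.deg i → f x ∈ a.deg (i + 2)) {i j : ℤ} {x y : K} (hx : x ∈ a.deg i)
    (hy : y ∈ a.deg j) :
    (Θ.shift h f hf).quad x y =
      Θ.quad x y + a.bracket (f x) y + a.bracket x (f y) - f (a.bracket x y) := by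
  have key := Θ.shift_bracket h f hf x y
  rw [bracket_eq _ h, bracket_eq _ h] at key
  simp only [LinearMap.add_apply, map_add] at key
  have fx := hf i x hx
  have fy := hf j y hy
  have cast : ∀ {p q : ℤ} {u : K}, u ∈ a.deg p → p = q → u ∈ a.deg q := fun hu e => e ▸ hu
  have b := fun p q x y hx hy => a.deg_bracket_mem (i := p) (j := q) (x := x) (y := y) hx hy
  have q := Θ.quad_mem_deg
  have r := Θ.quart_mem_deg
  have q' := (Θ.shift h f hf).quad_mem_deg
  have r' := (Θ.shift h f hf).quart_mem_deg
  -- `u`, `v`, `w`, `t` collect the terms of degrees 2, 4, 6, 8 of the difference of the two sides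
  -- of `shift_bracket`; the degree-0 terms cancel.
  have U := (a.eq_zero_of_add_eq_zero (n := i + j)
    (u := (Θ.shift h f hf).quad x y -
      (Θ.quad x y + a.bracket (f x) y + a.bracket x (f y) - f (a.bracket x y)))
    (v := (Θ.shift h f hf).quart x y + f ((Θ.shift h f hf).quad x y) - (Θ.quart x y
      + Θ.quad (f x) y + Θ.quad x (f y) + a.bracket (f x) (f y)))
    (w := f ((Θ.shift h f hf).quart x y) - (Θ.quart (f x) y + Θ.quart x (f y)
      + Θ.quad (f x) (f y)))
    (t := -Θ.quart (f x) (f y)) ?_ ?_ ?_ ?_ ?_).1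
  · exact sub_eq_zero.1 U
  · exact sub_mem (q' _ _ _ _ hx hy) (sub_mem (add_mem (add_mem (q _ _ _ _ hx hy)
      (cast (b _ _ _ _ fx hy) (by ring))) (cast (b _ _ _ _ hx fy) (by ring)))
      (hf _ _ (b _ _ _ _ hx hy)))
  · exact sub_mem (add_mem (r' _ _ _ _ hx hy) (cast (hf _ _ (q' _ _ _ _ hx hy)) (by ring)))
      (add_mem (add_mem (add_mem (r _ _ _ _ hx hy) (cast (q _ _ _ _ fx hy) (by ring)))
        (cast (q _ _ _ _ hx fy) (by ring))) (cast (b _ _ _ _ fx fy) (by ring)))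
  · exact sub_mem (cast (hf _ _ (r' _ _ _ _ hx hy)) (by ring))
      (add_mem (add_mem (cast (r _ _ _ _ fx hy) (by ring)) (cast (r _ _ _ _ hx fy) (by ring)))
        (cast (q _ _ _ _ fx fy) (by ring)))
  · exact neg_mem (cast (r _ _ _ _ fx fy) (by ring))
  · rw [← sub_eq_zero] at key
    rw [← key]
    abel

/-! ### The degree-2 bracket on `a₋` determines the whole bracket -/

section Uniqueness

variable {L' : Type*} [AddCommGroup L'] [Module ℝ L'] {g' : FilteredLieSuperalgebra L'}
  {φ' : GrIso g' a} {Θ} {Θ' : Splitting φ'}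

/-- Only `x` of degree -2 matters, since otherwise both sides vanish by degree. There `act_quad` on
`x` and `s` of degree -1 expresses `[s, μ(A, x)]` through values of `μ` on `a₋`, and transitivity
recovers `μ(A, x)`. -/
theorem quad_left_unique (h : a.IsTwoStep) (ht : a.IsTransitive)
    (hq : ∀ i j, i < 0 → j < 0 → ∀ x ∈ a.deg i, ∀ y ∈ a.deg j, Θ'.quad x y = Θ.quad x y)
    {A : K} (hA : A ∈ a.deg 0) {i : ℤ} {x : K} (hx : x ∈ a.deg i) :
    Θ'.quad A x = Θ.quad A x := by
  by_cases hi : i < -2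
  · simp [h.eq_zero (Or.inl hi) hx]
  by_cases hi' : -2 < i
  · rw [h.eq_zero (by omega) (Θ'.quad_mem_deg 0 i A x hA hx),
      h.eq_zero (by omega) (Θ.quad_mem_deg 0 i A x hA hx)]
  obtain rfl : i = -2 := by omega
  have m' := Θ'.quad_mem_deg 0 (-2) A x hA hx
  have m := Θ.quad_mem_deg 0 (-2) A x hA hx
  norm_num at m m'
  refine sub_eq_zero.1 (ht _ (sub_mem m' m) fun s hs => ?_)
  have ps := a.deg_le_part _ hs
  have px := a.deg_le_part _ hx
  have z1 : Θ'.quad A s = 0 := h.eq_zero (by omega) (Θ'.quad_mem_deg 0 (-1) A s hA hs)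
  have z2 : Θ.quad A s = 0 := h.eq_zero (by omega) (Θ.quad_mem_deg 0 (-1) A s hA hs)
  have z3 : a.bracket x s = 0 := h.eq_zero (by omega) (a.deg_bracket_mem hx hs)
  have e' := Θ'.act_quad h hA px ps
  have e := Θ.act_quad h hA px ps
  rw [hq (-2) (-1) (by decide) (by decide) x hx s hs,
    hq (-2) (-1) (by decide) (by decide) _ (a.ad_mem_deg hA hx) s hs,
    hq (-2) (-1) (by decide) (by decide) x hx _ (a.ad_mem_deg hA hs), e] at e'
  have s0 : superSign ((-2 : ℤ) : ZMod 2) ((-1 : ℤ) : ZMod 2) = 1 := by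
    rw [show ((-2 : ℤ) : ZMod 2) = 0 by decide, superSign_zero_left]
  -- All other terms vanish by degree, leaving equality of the brackets of `s` with the two values
  -- at `(A, x)`.
  simp only [z1, z2, z3, s0, one_smul, map_zero, sub_zero, zero_sub, neg_inj] at e'
  rw [a.skew (a.mem_part_zero (sub_mem m' m)) ps, superSign_zero_left, one_smul, map_sub, e',
    sub_self, neg_zero]

theorem quad_unique (h : a.IsTwoStep) (ht : a.IsTransitive)
    (hq : ∀ i j, i < 0 → j < 0 → ∀ x ∈ a.deg i, ∀ y ∈ a.deg j, Θ'.quad x y = Θ.quad x y) :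
    Θ'.quad = Θ.quad := by
  refine a.bilin_ext fun i j x y hx hy => ?_
  rcases lt_trichotomy i 0 with hi | rfl | hi
  · rcases lt_trichotomy j 0 with hj | rfl | hj
    · exact hq i j hi hj x hx y hy
    · have px := a.deg_le_part _ hx
      have py := a.deg_le_part _ hy
      rw [Θ'.quad_skew h px py, Θ.quad_skew h px py, quad_left_unique h ht hq hy hx]
    · simp [h.eq_zero (Or.inr hj) hy]
  · exact quad_left_unique h ht hq hx hy
  · simp [h.eq_zero (Or.inr hi) hx]

/-- In the degree-4 Jacobi identity on `x, y, s`, every other term contains a value in a degree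
outside -2, -1, 0. -/
theorem quart_bracket (h : a.IsTwoStep) {x y s : K} (hx : x ∈ a.deg (-2)) (hy : y ∈ a.deg (-2))
    (hs : s ∈ a.deg (-1)) : a.bracket (Θ.quart x y) s = jac 1 Θ.quad Θ.quad x y s := by
  have s0 : (1 : ℝ) = superSign ((-2 : ℤ) : ZMod 2) ((-2 : ℤ) : ZMod 2) := by
    rw [show ((-2 : ℤ) : ZMod 2) = 0 by decide, superSign_zero_left]
  have J := (Θ.jac_bracket_deg h hx hy hs 1 s0).2
  have z1 : Θ.quart x s = 0 := h.eq_zero (by omega) (Θ.quart_mem_deg _ _ _ _ hx hs)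
  have z2 : Θ.quart y s = 0 := h.eq_zero (by omega) (Θ.quart_mem_deg _ _ _ _ hy hs)
  have z3 : a.bracket x s = 0 := h.eq_zero (by omega) (a.deg_bracket_mem hx hs)
  have z4 : a.bracket y s = 0 := h.eq_zero (by omega) (a.deg_bracket_mem hy hs)
  have z5 : a.bracket x y = 0 := h.eq_zero (by omega) (a.deg_bracket_mem hx hy)
  rw [jac, jac, z1, z2, z3, z4, z5] at J
  simp only [map_zero, LinearMap.zero_apply, smul_zero, sub_zero, zero_sub, add_zero] at J
  exact (neg_add_eq_zero.1 J)

/-- A map of degree 4 can be nonzero only on two arguments of degree -2, with value in degree 0;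
there `quart_bracket` and transitivity apply. -/
theorem quart_unique (h : a.IsTwoStep) (ht : a.IsTransitive) (hq : Θ'.quad = Θ.quad) :
    Θ'.quart = Θ.quart := by
  refine a.bilin_ext fun i j x y hx hy => ?_
  by_cases hi : i < -2
  · simp [h.eq_zero (Or.inl hi) hx]
  by_cases hj : j < -2
  · simp [h.eq_zero (Or.inl hj) hy]
  have m' := Θ'.quart_mem_deg i j x y hx hy
  have m := Θ.quart_mem_deg i j x y hx hy
  by_cases hij : 0 < i + j + 4
  · rw [h.eq_zero (Or.inr hij) m', h.eq_zero (Or.inr hij) m]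
  obtain rfl : i = -2 := by omega
  obtain rfl : j = -2 := by omega
  refine sub_eq_zero.1 (ht _ (sub_mem m' m) fun s hs => ?_)
  rw [map_sub, LinearMap.sub_apply, quart_bracket h hx hy hs, quart_bracket h hx hy hs, hq,
    sub_self]

theorem bracket_unique (h : a.IsTwoStep) (ht : a.IsTransitive)
    (hq : ∀ i j, i < 0 → j < 0 → ∀ x ∈ a.deg i, ∀ y ∈ a.deg j, Θ'.quad x y = Θ.quad x y) :
    Θ'.bracket = Θ.bracket := by
  have e := quad_unique h ht hq
  rw [Θ'.bracket_eq h, Θ.bracket_eq h, quart_unique h ht e, e]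

/-- Filtered deformations with the same transported bracket are isomorphic. -/
def filteredIso (h : a.IsTwoStep) (e : Θ'.bracket = Θ.bracket) : FilteredIso g' g where
  equiv := Θ'.equiv.symm ≪≫ₗ Θ.equiv
  map_bracket x y := by
    have := Θ'.bracket_apply (Θ'.equiv.symm x) (Θ'.equiv.symm y)
    simp only [LinearEquiv.apply_symm_apply] at this
    rw [LinearEquiv.trans_apply, ← this, e, equiv_bracket]
    rfl
  map_part p x := by
    rw [LinearEquiv.trans_apply, Θ.mem_part_iff, ← Θ'.mem_part_iff,
      LinearEquiv.apply_symm_apply]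
  map_filt i x := by
    rw [LinearEquiv.trans_apply, Θ.mem_filt_iff h, ← Θ'.mem_filt_iff h,
      LinearEquiv.apply_symm_apply]

theorem nonempty_filteredIso (h : a.IsTwoStep) (ht : a.IsTransitive)
    (hc : Θ'.mu - Θ.mu ∈ a.coboundaries₂ 2) : Nonempty (FilteredIso g' g) := by
  obtain ⟨ψ, hψ, hd⟩ := hc
  -- Since `μ' - μ = ∂ψ`, shifting `Θ'` by `-ψ` makes the two degree-2 brackets agree on `a₋`.
  have hf := extend_mem (neg_mem hψ)
  refine ⟨filteredIso (Θ' := Θ'.shift h (a.extend (-ψ)) hf) (Θ := Θ) h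
    (bracket_unique h ht fun i j hi hj x hx y hy => ?_)⟩
  have nx := a.deg_le_neg hi hx
  have ny := a.deg_le_neg hj hy
  have px := a.deg_le_part i hx
  have py := a.deg_le_part j hy
  have e := hd _ _ ⟨x, nx⟩ ⟨y, ny⟩ px py
  have e1 := h.extend_apply (neg_mem hψ) ⟨x, nx⟩ hx
  have e2 := h.extend_apply (neg_mem hψ) ⟨y, ny⟩ hy
  have e3 := h.extend_apply (neg_mem hψ) (a.negBracket ⟨x, nx⟩ ⟨y, ny⟩) (a.deg_bracket_mem hx hy)
  have pf : ψ ⟨x, nx⟩ ∈ a.part (i : ZMod 2) := by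
    have := a.deg_le_part _ (hψ i ⟨x, nx⟩ hx)
    push_cast at this
    rwa [show (2 : ZMod 2) = 0 by decide, add_zero] at this
  rw [Θ'.shift_quad h _ hf hx hy]
  change a.extend (-ψ) x = _ at e1
  change a.extend (-ψ) y = _ at e2
  change a.extend (-ψ) (a.bracket x y) = _ at e3
  change Θ'.quad x y - Θ.quad x y = a.bracket x (ψ ⟨y, ny⟩)
    - superSign _ _ • a.bracket y (ψ ⟨x, nx⟩) - ψ (a.negBracket ⟨x, nx⟩ ⟨y, ny⟩) at e
  rw [e1, e2, e3]
  simp only [LinearMap.neg_apply, map_neg]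
  -- `shift_quad` produces `[ψ x, y]`, while `spencer₁` uses `[y, ψ x]` with a sign; `ψ x` has the
  -- parity of `x` because `ψ` has even degree.
  rw [a.skew pf py, ← sub_eq_zero, ← sub_eq_zero.2 e]
  module

end Uniqueness

end Splitting

/-! ### Faithfulness of the spinor representation -/

section Poincare

variable {V : Type*} [AddCommGroup V] [Module ℝ V] {η : LorentzForm V}
  {S : Type*} [AddCommGroup S] [Module ℝ S] [Module η.Cl S] [IsScalarTower ℝ η.Cl S]

/-- A vector that annihilates a nonzero Clifford module vanishes. -/
theorem LorentzForm.eq_zero_of_smul_eq_zero [Nontrivial S] {u : V}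
    (hu : ∀ s : S, η.ι u • s = 0) : u = 0 := by
  obtain ⟨s, hs⟩ := exists_ne (0 : S)
  have h : ∀ w, η.form w u = 0 := by
    intro w
    -- On `s` the anticommutator of `w` and `u` acts both as zero and as the scalar `-2 η(w, u)`.
    have e := congrArg (fun c : η.Cl => c • s) (η.ι_mul_add_swap w u)
    simp only [add_smul, mul_smul, hu, smul_zero, add_zero, smul_assoc, one_smul] at e
    simpa [hs] using e.symm
  rw [← η.sum_basis u]
  simp [h]

/-- The spinor representation is faithful. -/
theorem SpinorForm.eq_zero_of_sigma_eq_zero [Nontrivial S] {A : ↥η.so}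
    (hA : ∀ s : S, SpinorForm.sigma η S A s = 0) : A = 0 := by
  refine Subtype.ext (LinearMap.ext fun v => ?_)
  refine LorentzForm.eq_zero_of_smul_eq_zero (η := η) (S := S) fun s => ?_
  -- Clifford multiplication by `Av` is the commutator of `σ(A)` with multiplication by `v`, so it
  -- vanishes with `σ(A)`.
  have e := SpinorForm.sigma_ι A v s
  rw [hA, hA, smul_zero, zero_add] at e
  exact e.symm

variable {ω : SpinorForm η S} (a : GradedSubalgebra (poincare η ω))

theorem isTwoStep_toGraded : a.toGraded.IsTwoStep := by
  refine fun i hi => (Submodule.eq_bot_iff _).2 fun x hx => Subtype.ext ?_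
  exact Prod.ext (hx.1 (by omega)) (Prod.ext (hx.2.1 (by omega)) (hx.2.2 (by omega)))

/-- As `a` contains all of `S`, an element of degree 0 killing its degree -1 component has `σ(A) =
0`, and faithfulness applies. -/
theorem isTransitive_toGraded [Nontrivial S] (hS : (poincare η ω).deg (-1) ≤ a.carrier) :
    a.toGraded.IsTransitive := by
  rintro ⟨⟨v, s, A⟩, hm⟩ hA h
  obtain rfl : v = 0 := hA.1 (by decide)
  obtain rfl : s = 0 := hA.2.1 (by decide)
  have hA0 : A = 0 := by
    refine SpinorForm.eq_zero_of_sigma_eq_zero (S := S) fun t => ?_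
    have ht : ((0, t, 0) : V × S × ↥η.so) ∈ (poincare η ω).deg (-1) :=
      ⟨fun _ => rfl, fun h => absurd rfl h, fun _ => rfl⟩
    have e := congrArg Subtype.val (h ⟨(0, t, 0), hS ht⟩ ht)
    have e' : poincareBracket η ω (0, 0, A) (0, t, 0) = 0 := e
    rw [bracket_even_odd] at e'
    exact congrArg (fun p => p.2.1) e'
  subst hA0
  rfl

end Poincare

end

theorem proposition5p2 {V : Type*} [AddCommGroup V] [Module ℝ V] (η : LorentzForm V)
    {S : Type*} [AddCommGroup S] [Module ℝ S] [Module η.Cl S] [IsScalarTower ℝ η.Cl S]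
    [IsSimpleModule η.Cl S] (ω : SpinorForm η S)
    (a : GradedSubalgebra (poincare η ω))
    (hV : (poincare η ω).deg (-2) ≤ a.carrier) (hS : (poincare η ω).deg (-1) ≤ a.carrier)
    {L : Type*} [AddCommGroup L] [Module ℝ L] (g : FilteredLieSuperalgebra L)
    (φ : GrIso g a.toGraded) :
    Nonempty (Splitting φ) ∧
    (∀ Θ : Splitting φ, ∃ hμ : Θ.mu ∈ a.toGraded.cocycles₂ 2,
      a.toGraded.IsInvariantClass 2 (a.toGraded.cohClass 2 ⟨Θ.mu, hμ⟩)) ∧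
    (∀ {L' : Type*} [AddCommGroup L'] [Module ℝ L'] (g' : FilteredLieSuperalgebra L')
      (φ' : GrIso g' a.toGraded) (Θ : Splitting φ) (Θ' : Splitting φ')
      (hμ : Θ.mu ∈ a.toGraded.cocycles₂ 2) (hμ' : Θ'.mu ∈ a.toGraded.cocycles₂ 2),
      a.toGraded.cohClass 2 ⟨Θ'.mu, hμ'⟩ = a.toGraded.cohClass 2 ⟨Θ.mu, hμ⟩ →
        Nonempty (FilteredIso g' g)) := by
  have h2 := isTwoStep_toGraded a
  -- An irreducible module is nonzero, which is what faithfulness needs.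
  have : Nontrivial S := IsSimpleModule.nontrivial η.Cl S
  have ht := isTransitive_toGraded a hS
  refine ⟨φ.nonempty_splitting h2, fun Θ => ⟨Θ.mu_mem_cocycles h2,
    Θ.isInvariantClass_mu h2 _⟩, ?_⟩
  intro L' _ _ g' φ' Θ Θ' hμ hμ' hc
  have hd := (Submodule.Quotient.eq _).1 hc
  exact Splitting.nonempty_filteredIso h2 ht hd
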